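/- **Setting.** A monotone machine has two one-way read-only tapes (input and program), a one-way output tape, and a finite control with a two-way work tape. For $x,p,y\in\{0,1\}^*$, $y$ nonempty, write $T(x,p)=y$ if, when the input and program tapes of $T$ start with $x$ and $p$, the output starts with $y$, and at the moment when the last bit of $y$ is written the input and program heads are directly to the right of $x$ and $p$. Write $T(x,p)\downarrow$ if $T$ halts with its heads directly to the right of $x$ and $p$. Fix a universal monotone machine $U$: for every monotone machine $T$ there is $i\in\{0,1\}^*$ such that, for all $x,p,y$, $U(x,ip)=y\iff T(x,p)=y$ and $U(x,ip)\downarrow\iff T(x,p)\downarrow$. The stopping probability of $x$ is $M_{\mathrm{stop}}(x):=\sum_{p:\,U(x,p)\downarrow}2^{-|p|}$. Let $\mathcal A,\mathcal O,\mathcal R$ be nonempty countable sets of actions, observations and rewards, each encoded injectively into a self-delimiting (prefix-free) set of binary strings, with decidable sets of codewords; histories $h_{<t}=a_1o_1r_1\ldots a_{t-1}o_{t-1}r_{t-1}$, and strings $h_{<t}a_t$, are identified with the concatenated codewords. The rewards are symbols whose numerical values lie in $[-L,1]$, where $L>-1$, and one designated symbol has the value $-L$. The universal chronological prior $\xi(o_1r_1\ldots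 o_tr_t\,\|\,a_1\ldots a_t)$ is the probability that $U$, with the input tape starting with $a_1\ldots a_t$ and a program tape of independent fair random bits, outputs $o_1r_1\ldots o_tr_t$, where for each $s\le t$ the part $o_1r_1\ldots o_sr_s$ is written before any input beyond $a_1\ldots a_s$ is read. Put $\xi(o_tr_t\mid h_{<t}a_t):=\xi(o_1r_1\ldots o_tr_t\|a_1\ldots a_t)/\xi(o_1r_1\ldots o_{t-1}r_{t-1}\|a_1\ldots a_{t-1})$. For $\gamma\in(0,1)$ and a stochastic policy $\pi$ let $$V_\xi^\pi(h_{<t}):=\mathbb E_\xi^\pi\Big[(1-\gamma)\sum_{s\ge0}\gamma^s r_{t+s}\,\Big|\,h_{<t}\Big],\qquad V_\xi^*(h_{<t}):=\sup_\pi V_\xi^\pi(h_{<t}),$$ where a reward counts as $0$ if it is not issued because the environment has stopped. An optimizing policy $\pi_\xi^*$ is one with $V_\xi^{\pi_\xi^*}(h_{<t})=V_\xi^*(h_{<t})$. The agent $\pi^{\mathrm{GH}}$ keeps a counter of remaining rollout steps and a current mentor. At step $t$, if the counter is $0$: first, if $V_\xi^*(h_{<t})\le-1$, it sets the counter to $1$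 and picks an arbitrary mentor; then, with some probability $\eta(t)$, it sets the counter to $H(t)\ge1$ and picks a random mentor. If the counter is now positive, it is decreased by $1$ and the current mentor acts; otherwise the optimizing policy acts, i.e. $a_t\sim\pi_\xi^*(h_{<t})$. **Theorem (Safety).** There is a constant $C>0$, depending only on $U$, the encodings and the designated minimal reward symbol (and not on $L$, the values of the rewards, $\gamma$, the history, the mentors, $\eta$ or $H$), such that for every history $h_{<t}$: 1. If $M_{\mathrm{stop}}(h_{<t})\ge C/(L+1)$, then $V_\xi^*(h_{<t})\le-1$, so $\pi^{\mathrm{GH}}$ does not let the optimizing policy act at $h_{<t}$. 2. Whenever the optimizing policy does act at $h_{<t}$, every action $a_t$ that it takes (with positive probability) satisfies $M_{\mathrm{stop}}(h_{<t}a_t)<C/(L+1)$. -/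

import Mathlib

open scoped ENNReal

/-- What a monotone machine does in one step: it halts, computes internally, moves its input head
over one more bit, moves its program head over one more bit, or appends a bit to its output. -/
inductive Op : Type
  | halt
  | compute
  | readInput
  | readProgram
  | write (b : Bool)

/-- An enumeration of the six kinds of steps, used to speak of computable `Op`-valued functions. -/
def Op.equivFin : Op ≃ Fin 6 where
  toFun
    | .halt => 0
    | .compute => 1
    | .readInput => 2
    | .readProgram => 3
    | .write false => 4
    | .write true => 5
  invFun
    | 0 => .halt
    | 1 => .compute
    | 2 => .readInput
    | 3 => .readProgram
    | 4 => .write false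
    | 5 => .write true
  left_inv := by rintro (_ | _ | _ | _ | (_ | _)) <;> rfl
  right_inv := by intro k; fin_cases k <;> rfl

instance : Primcodable Op := Primcodable.ofEquiv (Fin 6) Op.equivFin

/-- A monotone machine: it has two one-way read-only tapes (input and program), a one-way output
tape, and a work memory. The joint contents of the finite control and of the two-way work tape (an
instantaneous description, a finite object) are coded by a natural number, the state. The kind of
the next step is a computable function of the state, and the next state is a computable function of
the state and of the bit that has just been read (`false` when the step reads no bit). -/
structure MonotoneMachine where
  start : ℕ
  op : ℕ → Op
  next : ℕ → Bool → ℕ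
  op_computable : Computable op
  next_computable : Computable₂ next

namespace MonotoneMachine

/-- `T.Reaches s x p y`: when the input tape starts with `x` and the program tape starts with `p`,
there is a moment at which `T` is in state `s`, its input and program heads are directly to the
right of `x` and `p`, and exactly `y` has been written. -/
inductive Reaches (T : MonotoneMachine) : ℕ → List Bool → List Bool → List Bool → Prop
  | start : Reaches T T.start [] [] []
  | compute {s : ℕ} {x p y : List Bool} (h : Reaches T s x p y) (hs : T.op s = .compute) :
      Reaches T (T.next s false) x p y
  | readInput {s : ℕ} {x p y : List Bool} (b : Bool) (h : Reaches T s x p y)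
      (hs : T.op s = .readInput) : Reaches T (T.next s b) (x ++ [b]) p y
  | readProgram {s : ℕ} {x p y : List Bool} (b : Bool) (h : Reaches T s x p y)
      (hs : T.op s = .readProgram) : Reaches T (T.next s b) x (p ++ [b]) y
  | write {s : ℕ} {x p y : List Bool} {b : Bool} (h : Reaches T s x p y)
      (hs : T.op s = .write b) : Reaches T (T.next s false) x p (y ++ [b])

/-- `T(x, p) = y` for a nonempty `y`: at the moment when the last bit of `y` is written, the input
and program heads are directly to the right of `x` and `p`. -/
def Outputs (T : MonotoneMachine) (x p y : List Bool) : Prop :=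
  ∃ (s : ℕ) (z : List Bool) (b : Bool), T.Reaches s x p z ∧ T.op s = .write b ∧ y = z ++ [b]

/-- `T(x, p)↓`: the machine halts with its input and program heads directly to the right of `x`
and `p`. -/
def Halts (T : MonotoneMachine) (x p : List Bool) : Prop :=
  ∃ (s : ℕ) (y : List Bool), T.Reaches s x p y ∧ T.op s = .halt

/-- `U` is universal: every monotone machine `T` is simulated by `U` after some fixed instruction
`i` is prepended to the program. -/
def IsUniversal (U : MonotoneMachine) : Prop :=
  ∀ T : MonotoneMachine, ∃ i : List Bool, ∀ x p : List Bool,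
    (∀ y : List Bool, U.Outputs x (i ++ p) y ↔ T.Outputs x p y) ∧
      (U.Halts x (i ++ p) ↔ T.Halts x p)

/-- The stopping probability of `x`: the sum of `2 ^ (-|p|)` over all `p` with `U(x, p)↓`. -/
noncomputable def stopProb (U : MonotoneMachine) (x : List Bool) : ℝ≥0∞ :=
  ∑' p : {p : List Bool // U.Halts x p}, (2 : ℝ≥0∞)⁻¹ ^ p.val.length

end MonotoneMachine

/-- An encoding of `α`: an injection into a self-delimiting set of binary strings (no codeword is a
prefix of the codeword of another element), where it can be decided whether a string is a
codeword. -/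
structure SelfDelimitingCode (α : Type*) where
  enc : α → List Bool
  eq_of_prefix : ∀ a b : α, enc a <+: enc b → a = b
  decidable_range : ComputablePred fun w : List Bool => w ∈ Set.range enc

/-- The data of one time step: an action, an observation and a reward. -/
abbrev Step (A O R : Type*) := A × O × R

/-- Encodings of the actions, the observations and the rewards. -/
structure HistoryCode (A O R : Type*) where
  action : SelfDelimitingCode A
  observation : SelfDelimitingCode O
  reward : SelfDelimitingCode R

namespace HistoryCode

variable {A O R : Type*} (c : HistoryCode A O R)

/-- The binary string `a₁ a₂ … aₜ`. -/
def actions (h : List (Step A O R)) : List Bool :=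
  h.flatMap fun e => c.action.enc e.1

/-- The binary string `o₁ r₁ o₂ r₂ … oₜ rₜ`. -/
def percepts (h : List (Step A O R)) : List Bool :=
  h.flatMap fun e => c.observation.enc e.2.1 ++ c.reward.enc e.2.2

/-- The binary string `a₁ o₁ r₁ … aₜ oₜ rₜ`. -/
def history (h : List (Step A O R)) : List Bool :=
  h.flatMap fun e => c.action.enc e.1 ++ c.observation.enc e.2.1 ++ c.reward.enc e.2.2

end HistoryCode

/-- The law of an infinite sequence of independent uniformly random bits. -/
noncomputable def randomTape : MeasureTheory.Measure (ℕ → Bool) :=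
  MeasureTheory.Measure.infinitePi fun _ => (PMF.uniformOfFintype Bool).toMeasure

/-- The first `n` bits of an infinite tape. -/
def tapePrefix (w : ℕ → Bool) (n : ℕ) : List Bool :=
  (List.range n).map w

section Environment

variable {A O R : Type*}

/-- The chronological machine obtained from `U`, with program tape `w`, answers the actions of `h`
by the percepts of `h`: for every initial part `g` of `h`, the machine has written all percepts of
`g` at a moment at which it has not yet read any input beyond the actions of `g`. -/
def ChronologicalOutputs (U : MonotoneMachine) (c : HistoryCode A O R) (w : ℕ → Bool)
    (h : List (Step A O R)) : Prop :=
  ∀ g : List (Step A O R), g <+: h → ∃ (s : ℕ) (x : List Bool) (n : ℕ),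
    x <+: c.actions g ∧ U.Reaches s x (tapePrefix w n) (c.percepts g)

/-- The universal prior `ξ(or₁ … orₜ ‖ a₁ … aₜ)`: the probability that the chronological machine,
run on a uniformly random program tape, answers the actions of `h` by the percepts of `h`. -/
noncomputable def universalPrior (U : MonotoneMachine) (c : HistoryCode A O R)
    (h : List (Step A O R)) : ℝ :=
  (randomTape {w | ChronologicalOutputs U c w h}).toReal

/-- A stochastic environment `ν(o r | h a)`; its values may add up to less than one. -/
abbrev Environment (A O R : Type*) := List (Step A O R) → A → O × R → ℝ

/-- A stochastic policy `π(a | h)`. -/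
abbrev Policy (A O R : Type*) := List (Step A O R) → PMF A

/-- The conditional probabilities `ξ(o r | h a)` of the universal prior. -/
noncomputable def universalEnv (U : MonotoneMachine) (c : HistoryCode A O R) : Environment A O R :=
  fun h a e => universalPrior U c (h ++ [(a, e)]) / universalPrior U c h

/-- The probability that the history `h` is continued by `k` when `π` interacts with `ν`. -/
noncomputable def continuationProb (π : Policy A O R) (ν : Environment A O R) :
    List (Step A O R) → List (Step A O R) → ℝ
  | _, [] => 1
  | h, e :: k => (π h e.1).toReal * ν h e.1 e.2 * continuationProb π ν (h ++ [e]) k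

/-- The value `V_ν^π(h)`: the normalized discounted sum of the expected rewards after `h`. A reward
that is not issued because the environment has stopped counts as `0`. -/
noncomputable def value (γ : ℝ) (rew : R → ℝ) (π : Policy A O R) (ν : Environment A O R)
    (h : List (Step A O R)) : ℝ :=
  (1 - γ) * ∑' s : ℕ, γ ^ s * ∑' k : Fin (s + 1) → Step A O R,
    continuationProb π ν h (List.ofFn k) * rew (k (Fin.last s)).2.2

/-- The optimal value `V_ν^*(h)`. -/
noncomputable def optimalValue (γ : ℝ) (rew : R → ℝ) (ν : Environment A O R)
    (h : List (Step A O R)) : ℝ :=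
  ⨆ π : Policy A O R, value γ rew π ν h

/-- The policy `π` attains the maximum of the value at the history `h`. -/
def IsOptimalAt (γ : ℝ) (rew : R → ℝ) (ν : Environment A O R) (π : Policy A O R)
    (h : List (Step A O R)) : Prop :=
  ∀ π' : Policy A O R, value γ rew π' ν h ≤ value γ rew π ν h

end Environment

/-- The internal state of the Golden Handcuffs agent: the number of remaining steps of the current
rollout, and the current mentor (an index from `ι`). -/
structure AgentState (ι : Type*) where
  rolloutSteps : ℕ
  mentor : ι

open Classical in
/-- The first half of an iteration of the agent, in which it is decided who acts. If no rollout is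
in progress, then the safety trigger (the proposition `safety`) starts a rollout of one step by an
arbitrary mentor `m`, and the random trigger (`coin = some τ` when it fires and selects the mentor
`τ`, and `coin = none` when it does not fire) starts a rollout of `H` steps by `τ`. -/
noncomputable def AgentState.update {ι : Type*} (σ : AgentState ι) (safety : Prop) (m : ι) (H : ℕ)
    (coin : Option ι) : AgentState ι :=
  if σ.rolloutSteps = 0 then
    let σ₁ : AgentState ι := if safety then ⟨1, m⟩ else σ
    match coin with
    | none => σ₁
    | some τ => ⟨H, τ⟩
  else σ

/-- In this iteration the action is sampled from the optimizing policy (otherwise it is sampled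
from the mentor recorded in the updated state). -/
def AgentState.OptimizerActs {ι : Type*} (σ : AgentState ι) (safety : Prop) (m : ι) (H : ℕ)
    (coin : Option ι) : Prop :=
  ¬ 0 < (σ.update safety m H coin).rolloutSteps

/-! A stopping program turns into an environment that issues the worst reward forever. The machine
`doom` runs two programs for `U` side by side, one on the even and one on the odd bits of its
program tape. The first is an environment program that answers the actions; the second is a stopping
program that is fed the history arising in this way. Once the second program halts, `doom` writes a
fixed percept `d` again and again. The even and odd bits of a fair tape are independent fair tapes
(`map_interleave`). So `doom` answers `h` and then continues with copies of `d` with probability at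
least the product of the probability that `U` answers `h` and the stopping probability of `h`.
Universality costs a factor `2 ^ (-n)`, where `n` depends only on `U`, the encodings and `d`
(`exists_mul_stopProb_le`).

Let `d` carry the reward `-L`. Conditionally on `h`, it is then issued forever with probability at
least `q = 2 ^ (-n) * M_stop(h)`, whatever the actions. As rewards are at most `1` and missing
rewards count as `0`, every policy has value at most `1 - (1 + L) * q`
(`value_le_of_constant_percepts`). This is at most `-1` once `q ≥ 2 / (L + 1)`, which explains `C =
2 ^ (n + 1)`.

For the second claim the stopping program reads the next action `a` too, and the same bound holds
for policies that play `a` at `h`. The value is affine in the law of the next action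
(`value_eq_add`), so an optimal policy that plays `a` with positive probability is worth no more
than the policy that plays `a` surely and then follows it. Then the optimal value would be at most
`-1`, and the safety trigger would have fired. -/

open MeasureTheory MonotoneMachine

/-! ### Random tapes -/

theorem length_tapePrefix (w : ℕ → Bool) (n : ℕ) : (tapePrefix w n).length = n := by
  simp [tapePrefix]

theorem getElem_tapePrefix (w : ℕ → Bool) (n i : ℕ) (h : i < (tapePrefix w n).length) :
    (tapePrefix w n)[i] = w i := by
  simp [tapePrefix]

theorem tapePrefix_succ (w : ℕ → Bool) (n : ℕ) :
    tapePrefix w (n + 1) = tapePrefix w n ++ [w n] := by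
  simp [tapePrefix, List.range_succ]

theorem tapePrefix_eq_iff {w : ℕ → Bool} {n : ℕ} {p : List Bool} :
    tapePrefix w n = p ↔ p.length = n ∧ ∀ i (h : i < p.length), w i = p[i] := by
  constructor
  · rintro rfl
    exact ⟨length_tapePrefix w n, fun i h => (getElem_tapePrefix w n i h).symm⟩
  · rintro ⟨rfl, h⟩
    refine List.ext_getElem (length_tapePrefix _ _) fun i h₁ h₂ => ?_
    rw [getElem_tapePrefix, h i h₂]

/-- The program `p` is an initial part of the tape `w`. -/
def OnTape (w : ℕ → Bool) (p : List Bool) : Prop :=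
  tapePrefix w p.length = p

theorem onTape_tapePrefix (w : ℕ → Bool) (n : ℕ) : OnTape w (tapePrefix w n) := by
  rw [OnTape, length_tapePrefix]

theorem onTape_iff {w : ℕ → Bool} {p : List Bool} :
    OnTape w p ↔ ∀ i (h : i < p.length), w i = p[i] := by
  rw [OnTape, tapePrefix_eq_iff]; simp

theorem onTape_nil (w : ℕ → Bool) : OnTape w [] := rfl

theorem OnTape.of_prefix {w : ℕ → Bool} {p q : List Bool} (h : OnTape w q) (hpq : p <+: q) :
    OnTape w p := by
  rw [onTape_iff] at *
  intro i hi
  rw [h i (hi.trans_le hpq.length_le), hpq.getElem]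

theorem onTape_concat {w : ℕ → Bool} {p : List Bool} {b : Bool} :
    OnTape w (p ++ [b]) ↔ OnTape w p ∧ w p.length = b := by
  rw [OnTape, List.length_append, List.length_singleton, tapePrefix_succ,
    List.append_eq_append_iff_of_size_eq_left (length_tapePrefix _ _)]
  simp [OnTape]

theorem measurableSet_onTape (p : List Bool) : MeasurableSet {w | OnTape w p} := by
  simp only [onTape_iff]
  measurability

instance : IsProbabilityMeasure randomTape := by
  unfold randomTape; infer_instance

theorem randomTape_pi_range (n : ℕ) (f : ℕ → Bool) :
    randomTape {w | ∀ i < n, w i = f i} = 2⁻¹ ^ n := by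
  have : {w : ℕ → Bool | ∀ i < n, w i = f i} = Set.pi (Finset.range n) fun i => {f i} := by
    ext w; simp
  rw [this, randomTape, Measure.infinitePi_pi _ fun i _ => measurableSet_singleton _]
  simp

theorem randomTape_onTape (p : List Bool) : randomTape {w | OnTape w p} = 2⁻¹ ^ p.length := by
  rw [← randomTape_pi_range p.length fun i => p.getD i false]
  congr 1 with w
  simp only [onTape_iff, Set.mem_ofPred_eq]
  refine forall₂_congr fun i hi => ?_
  rw [List.getD_eq_getElem _ _ hi]

/-- An event that depends on finitely many coordinates is a countable disjoint union of cylinders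
over strings of one common length, so the cylinders determine the measure. -/
theorem eq_randomTape {ν : Measure (ℕ → Bool)}
    (h : ∀ p : List Bool, ν {w | OnTape w p} = 2⁻¹ ^ p.length) : ν = randomTape := by
  have key : ∀ (ρ : Measure (ℕ → Bool)) (n : ℕ) (S : Set (List Bool)),
      ρ {w | tapePrefix w n ∈ S} =
        ∑' p : {p : List Bool // p ∈ S ∧ p.length = n}, ρ {w | OnTape w p.1} := by
    intro ρ n S
    rw [← measure_iUnion (f := fun p : {p : List Bool // p ∈ S ∧ p.length = n} =>
      {w | OnTape w p.1}) _ fun p => measurableSet_onTape p.1]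
    · congr 1 with w
      simp only [Set.mem_ofPred_eq, Set.mem_iUnion, Subtype.exists]
      constructor
      · intro hw
        exact ⟨_, ⟨hw, length_tapePrefix w n⟩, onTape_tapePrefix w n⟩
      · rintro ⟨p, ⟨hp, rfl⟩, hw⟩
        rwa [hw]
    · rintro ⟨p, hp, hpn⟩ ⟨q, hq, hqn⟩ hne
      refine Set.disjoint_left.2 fun w hw₁ hw₂ => hne (Subtype.ext ?_)
      simp only [Set.mem_ofPred_eq, OnTape, hpn, hqn] at hw₁ hw₂
      exact hw₁.symm.trans hw₂
  refine Measure.eq_infinitePi _ fun s t ht => ?_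
  rw [← Measure.infinitePi_pi _ fun i _ => ht i]
  change _ = randomTape _
  obtain ⟨n, hn⟩ : ∃ n, ∀ i ∈ s, i < n :=
    ⟨s.sup id + 1, fun i hi => Nat.lt_succ_of_le (Finset.le_sup (f := id) hi)⟩
  have hset : Set.pi (s : Set ℕ) t =
      {w | tapePrefix w n ∈ {p : List Bool | ∀ i ∈ s, p.getD i false ∈ t i}} := by
    ext w
    simp only [Set.mem_pi, Set.mem_ofPred_eq, Finset.mem_coe]
    refine forall₂_congr fun i hi => ?_
    rw [List.getD_eq_getElem _ _ (by rw [length_tapePrefix]; exact hn i hi), getElem_tapePrefix]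
  rw [hset, key, key]
  simp [h, randomTape_onTape]

/-! ### Prepending bits to a random tape -/

/-- The tape that starts with the bit `b` and continues with `w`. -/
def consTape (b : Bool) (w : ℕ → Bool) : ℕ → Bool
  | 0 => b
  | n + 1 => w n

theorem measurable_consTape (b : Bool) : Measurable (consTape b) := by
  refine measurable_pi_iff.2 fun n => ?_
  cases n with
  | zero => exact measurable_const
  | succ n => exact measurable_pi_apply n

theorem onTape_consTape {b c : Bool} {w : ℕ → Bool} {p : List Bool} :
    OnTape (consTape b w) (c :: p) ↔ b = c ∧ OnTape w p := by
  simp only [onTape_iff]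
  constructor
  · intro h
    exact ⟨h 0 (by simp), fun i hi => h (i + 1) (by simpa using hi)⟩
  · rintro ⟨rfl, h⟩ (_ | i) hi
    · rfl
    · exact h i (by simpa using hi)

/-- Conditioning on the first bit: on a cylinder over `c :: p`, only the summand with first bit `c`
contributes. -/
theorem randomTape_eq_average :
    (2⁻¹ : ℝ≥0∞) • (randomTape.map (consTape false) + randomTape.map (consTape true)) =
      randomTape := by
  refine eq_randomTape fun p => ?_
  rw [Measure.smul_apply, Measure.add_apply,
    Measure.map_apply (measurable_consTape _) (measurableSet_onTape p),
    Measure.map_apply (measurable_consTape _) (measurableSet_onTape p)]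
  cases p with
  | nil =>
    simp only [onTape_nil, Set.ofPred_true, Set.preimage_univ, measure_univ, smul_eq_mul,
      List.length_nil, pow_zero, one_add_one_eq_two]
    exact ENNReal.inv_mul_cancel two_ne_zero ENNReal.ofNat_ne_top
  | cons c p =>
    simp only [Set.preimage_ofPred_eq, onTape_consTape]
    cases c <;> simp [randomTape_onTape, pow_succ, mul_comm]

theorem randomTape_preimage_consTape_le (b : Bool) (E : Set (ℕ → Bool)) :
    2⁻¹ * randomTape (consTape b ⁻¹' E) ≤ randomTape E := by
  have h := congrArg (fun μ : Measure (ℕ → Bool) => μ E) randomTape_eq_average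
  simp only [Measure.smul_apply, Measure.add_apply, smul_eq_mul] at h
  rw [← h]
  gcongr
  cases b
  · exact (Measure.le_map_apply (measurable_consTape _).aemeasurable E).trans le_self_add
  · exact (Measure.le_map_apply (measurable_consTape _).aemeasurable E).trans le_add_self

/-- The tape that starts with the string `i` and continues with `w`. -/
def appendTape (i : List Bool) (w : ℕ → Bool) : ℕ → Bool :=
  i.foldr consTape w

theorem onTape_appendTape {i : List Bool} {w : ℕ → Bool} {p : List Bool} :
    OnTape (appendTape i w) (i ++ p) ↔ OnTape w p := by
  induction i with
  | nil => rfl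
  | cons b i ih => exact onTape_consTape.trans ((and_iff_right rfl).trans ih)

/-- This is the price of simulation: a fair tape starts with the instruction `i` with probability `2
^ (-|i|)`, and what follows is again fair. -/
theorem randomTape_preimage_appendTape_le (i : List Bool) (E : Set (ℕ → Bool)) :
    2⁻¹ ^ i.length * randomTape (appendTape i ⁻¹' E) ≤ randomTape E := by
  induction i generalizing E with
  | nil =>
    rw [List.length_nil, pow_zero, one_mul]
    exact le_rfl
  | cons b i ih =>
    calc 2⁻¹ ^ (i.length + 1) * randomTape (appendTape (b :: i) ⁻¹' E)
        = 2⁻¹ * (2⁻¹ ^ i.length * randomTape (appendTape i ⁻¹' (consTape b ⁻¹' E))) := by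
          rw [pow_succ', mul_assoc]; rfl
      _ ≤ 2⁻¹ * randomTape (consTape b ⁻¹' E) := by gcongr; exact ih _
      _ ≤ randomTape E := randomTape_preimage_consTape_le b E

/-! ### Two independent tapes on one tape -/

/-- The tape whose bits at even and at odd positions are those of `v.1` and `v.2`. -/
def interleave (v : (ℕ → Bool) × (ℕ → Bool)) (n : ℕ) : Bool :=
  if n % 2 = 0 then v.1 (n / 2) else v.2 (n / 2)

theorem interleave_even (v : (ℕ → Bool) × (ℕ → Bool)) (n : ℕ) :
    interleave v (2 * n) = v.1 n := by
  simp [interleave]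

theorem interleave_odd (v : (ℕ → Bool) × (ℕ → Bool)) (n : ℕ) :
    interleave v (2 * n + 1) = v.2 n := by
  have : (2 * n + 1) / 2 = n := by omega
  simp [interleave, this]

theorem measurable_interleave : Measurable interleave := by
  refine measurable_pi_iff.2 fun n => ?_
  unfold interleave
  split_ifs <;> fun_prop

/-- A cylinder over `p` pulls back to a product of two cylinders, which fix `⌈|p|/2⌉` and `⌊|p|/2⌋`
bits; these numbers add up to `|p|`. -/
theorem map_interleave : (randomTape.prod randomTape).map interleave = randomTape := by
  refine eq_randomTape fun p => ?_
  rw [Measure.map_apply measurable_interleave (measurableSet_onTape p)]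
  have : interleave ⁻¹' {w | OnTape w p} =
      {w | ∀ i < (p.length + 1) / 2, w i = p.getD (2 * i) false} ×ˢ
        {w | ∀ i < p.length / 2, w i = p.getD (2 * i + 1) false} := by
    ext v
    simp only [Set.mem_preimage, Set.mem_ofPred_eq, onTape_iff, Set.mem_prod]
    constructor
    · intro h
      refine ⟨fun i hi => ?_, fun i hi => ?_⟩
      · rw [List.getD_eq_getElem _ _ (by omega), ← h, interleave_even]
      · rw [List.getD_eq_getElem _ _ (by omega), ← h, interleave_odd]
    · rintro ⟨h₁, h₂⟩ i hi
      rw [← List.getD_eq_getElem _ false]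
      rcases Nat.even_or_odd' i with ⟨k, rfl | rfl⟩
      · rw [interleave_even, h₁ k (by omega)]
      · rw [interleave_odd, h₂ k (by omega)]
  rw [this, Measure.prod_prod, randomTape_pi_range _ fun i => p.getD (2 * i) false,
    randomTape_pi_range _ fun i => p.getD (2 * i + 1) false, ← pow_add]
  congr 1
  omega

theorem randomTape_mul_le {E F G : Set (ℕ → Bool)}
    (h : ∀ v ∈ E, ∀ w ∈ F, interleave (v, w) ∈ G) :
    randomTape E * randomTape F ≤ randomTape G :=
  calc randomTape E * randomTape F = (randomTape.prod randomTape) (E ×ˢ F) :=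
        (Measure.prod_prod E F).symm
    _ ≤ (randomTape.prod randomTape) (interleave ⁻¹' G) :=
        measure_mono fun v hv => h v.1 hv.1 v.2 hv.2
    _ ≤ (randomTape.prod randomTape).map interleave G :=
        Measure.le_map_apply measurable_interleave.aemeasurable G
    _ = randomTape G := by rw [map_interleave]

/-! ### Runs of monotone machines on fixed tapes -/

namespace MonotoneMachine

/-- What is visible of a computation at one moment: the state, the parts of the two tapes that have
been read, and what has been written. -/
@[ext] structure Config where
  state : ℕ
  input : List Bool
  program : List Bool
  output : List Bool

/-- One step of `T` on the finite input `X` and the program tape `w`. -/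
def TapeStep (T : MonotoneMachine) (X : List Bool) (w : ℕ → Bool) (k l : Config) : Prop :=
  match T.op k.state with
  | .halt => False
  | .compute => l = ⟨T.next k.state false, k.input, k.program, k.output⟩
  | .readInput => ∃ b, k.input ++ [b] <+: X ∧
      l = ⟨T.next k.state b, k.input ++ [b], k.program, k.output⟩
  | .readProgram => l = ⟨T.next k.state (w k.program.length), k.input,
      k.program ++ [w k.program.length], k.output⟩
  | .write b => l = ⟨T.next k.state false, k.input, k.program, k.output ++ [b]⟩

/-- `T` gets from the first moment to the second one on the finite input `X` and the program
tape `w`. -/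
def Leads (T : MonotoneMachine) (X : List Bool) (w : ℕ → Bool) : Config → Config → Prop :=
  Relation.ReflTransGen (T.TapeStep X w)

variable {T : MonotoneMachine} {X : List Bool} {w : ℕ → Bool}

/-- With both tapes fixed the machine is deterministic: the bit read from the input is dictated by
`X`, and the run is stuck where `X` ends. -/
theorem rightUnique_tapeStep : Relator.RightUnique (T.TapeStep X w) := by
  intro k l m hl hm
  unfold TapeStep at hl hm
  cases hs : T.op k.state <;> simp only [hs] at hl hm
  · exact hl.trans hm.symm
  · obtain ⟨b, hb, rfl⟩ := hl
    obtain ⟨d, hd, rfl⟩ := hm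
    have := (List.prefix_of_prefix_length_le hb hd (by simp)).eq_of_length (by simp)
    obtain rfl : b = d := by simpa using this
    rfl
  · exact hl.trans hm.symm
  · exact hl.trans hm.symm

theorem Reaches.leads {s : ℕ} {x p y : List Bool} (h : T.Reaches s x p y) (hx : x <+: X)
    (hp : OnTape w p) : T.Leads X w ⟨T.start, [], [], []⟩ ⟨s, x, p, y⟩ := by
  induction h with
  | start => exact Relation.ReflTransGen.refl
  | compute _ hs ih => exact (ih hx hp).tail (by simp [TapeStep, hs])
  | readInput b _ hs ih =>
    exact (ih ((List.prefix_append _ _).trans hx) hp).tail (by simpa [TapeStep, hs] using hx)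
  | readProgram b _ hs ih =>
    obtain ⟨hp', rfl⟩ := onTape_concat.1 hp
    exact (ih hx hp').tail (by simp [TapeStep, hs])
  | write _ hs ih => exact (ih hx hp).tail (by simp [TapeStep, hs])

theorem TapeStep.prefix {k l : Config} (h : T.TapeStep X w k l) :
    k.input <+: l.input ∧ k.program <+: l.program ∧ k.output <+: l.output := by
  unfold TapeStep at h
  split at h
  · exact h.elim
  · simp [h]
  · obtain ⟨b, -, rfl⟩ := h
    simp
  · simp [h]
  · simp [h]

theorem Leads.prefix {k l : Config} (h : T.Leads X w k l) :
    k.input <+: l.input ∧ k.program <+: l.program ∧ k.output <+: l.output := by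
  induction h with
  | refl => simp
  | tail _ hs ih =>
    obtain ⟨h₁, h₂, h₃⟩ := hs.prefix
    exact ⟨ih.1.trans h₁, ih.2.1.trans h₂, ih.2.2.trans h₃⟩

theorem Leads.eq_of_halt {k l : Config} (h : T.Leads X w k l) (hk : T.op k.state = .halt) :
    k = l := by
  rcases Relation.ReflTransGen.cases_head h with h | ⟨m, hm, -⟩
  · exact h
  · simp [TapeStep, hk] at hm

/-- Any two moments on the same tapes lie on one deterministic run, so one of them precedes the
other. -/
theorem Reaches.leads_or_leads {s s' : ℕ} {x p y x' p' y' : List Bool} (h : T.Reaches s x p y)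
    (h' : T.Reaches s' x' p' y') (hx : x <+: X) (hx' : x' <+: X) (hp : OnTape w p)
    (hp' : OnTape w p') :
    T.Leads X w ⟨s, x, p, y⟩ ⟨s', x', p', y'⟩ ∨ T.Leads X w ⟨s', x', p', y'⟩ ⟨s, x, p, y⟩ :=
  Relation.ReflTransGen.total_of_right_unique rightUnique_tapeStep (h.leads hx hp)
    (h'.leads hx' hp')

theorem Halts.unique {x p p' : List Bool} (h : T.Halts x p) (h' : T.Halts x p')
    (hp : OnTape w p) (hp' : OnTape w p') : p = p' := by
  obtain ⟨s, y, hr, hs⟩ := h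
  obtain ⟨s', y', hr', hs'⟩ := h'
  rcases hr.leads_or_leads hr' (List.prefix_refl x) (List.prefix_refl x) hp hp' with h | h
  · exact congrArg Config.program (h.eq_of_halt hs)
  · exact (congrArg Config.program (h.eq_of_halt hs')).symm

/-- At most one initial part of a tape is a halting program for `x`, so the cylinders over the
halting programs are disjoint and the sum is a probability. -/
theorem stopProb_eq (T : MonotoneMachine) (x : List Bool) :
    T.stopProb x = randomTape {w | ∃ p, T.Halts x p ∧ OnTape w p} := by
  have : {w | ∃ p, T.Halts x p ∧ OnTape w p} =
      ⋃ p : {p : List Bool // T.Halts x p}, {w | OnTape w p.1} := by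
    ext w; simp
  rw [this, measure_iUnion (f := fun p : {p : List Bool // T.Halts x p} => {w | OnTape w p.1}) _
    fun p => measurableSet_onTape p.1]
  · simp only [randomTape_onTape, stopProb]
  · rintro ⟨p, hp⟩ ⟨q, hq⟩ hne
    exact Set.disjoint_left.2 fun w hw₁ hw₂ => hne (Subtype.ext (hp.unique hq hw₁ hw₂))

/-- Go back to the moment at which the last bit of `y` was written. This passes from `Reaches`, used
for the prior, to `Outputs`, in which universality is phrased. -/
theorem Reaches.exists_outputs {s : ℕ} {x p y : List Bool} (h : T.Reaches s x p y)
    (hy : y ≠ []) : ∃ x' p', x' <+: x ∧ p' <+: p ∧ T.Outputs x' p' y := by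
  induction h with
  | start => exact absurd rfl hy
  | compute _ _ ih => exact ih hy
  | readInput b _ _ ih =>
    obtain ⟨x', p', hx, hp, ho⟩ := ih hy
    exact ⟨x', p', hx.trans (List.prefix_append _ _), hp, ho⟩
  | readProgram b _ _ ih =>
    obtain ⟨x', p', hx, hp, ho⟩ := ih hy
    exact ⟨x', p', hx, hp.trans (List.prefix_append _ _), ho⟩
  | write h hs => exact ⟨_, _, List.prefix_refl _, List.prefix_refl _, _, _, _, h, hs, rfl⟩

theorem Outputs.exists_reaches {x p y : List Bool} (h : T.Outputs x p y) :
    ∃ s, T.Reaches s x p y := by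
  obtain ⟨s, z, b, hr, hs, rfl⟩ := h
  exact ⟨_, hr.write hs⟩

end MonotoneMachine

/-! ### Chronological answers and universality -/

section Prior

variable {A O R : Type*} {c : HistoryCode A O R} {T U : MonotoneMachine} {w : ℕ → Bool}

theorem chronologicalOutputs_iff {h : List (Step A O R)} :
    ChronologicalOutputs U c w h ↔ ∀ g : List (Step A O R), g <+: h → ∃ s x p,
      x <+: c.actions g ∧ OnTape w p ∧ U.Reaches s x p (c.percepts g) := by
  refine forall₂_congr fun g _ => ⟨?_, ?_⟩
  · rintro ⟨s, x, n, hx, hr⟩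
    exact ⟨s, x, _, hx, onTape_tapePrefix w n, hr⟩
  · rintro ⟨s, x, p, hx, hp, hr⟩
    exact ⟨s, x, p.length, hx, by rwa [hp]⟩

theorem ChronologicalOutputs.of_prefix {g h : List (Step A O R)}
    (hw : ChronologicalOutputs U c w h) (hg : g <+: h) : ChronologicalOutputs U c w g :=
  fun k hk => hw k (hk.trans hg)

/-- A universal machine answers by the percepts of a history with a probability that is not less,
up to a constant factor, than that of any other machine. -/
theorem MonotoneMachine.IsUniversal.exists_mul_le (hU : U.IsUniversal) (c : HistoryCode A O R)
    (T : MonotoneMachine) : ∃ n : ℕ, ∀ h : List (Step A O R),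
      2⁻¹ ^ n * randomTape {w | ChronologicalOutputs T c w h} ≤
        randomTape {w | ChronologicalOutputs U c w h} := by
  obtain ⟨i, hi⟩ := hU T
  refine ⟨i.length, fun h => le_trans ?_ (randomTape_preimage_appendTape_le i _)⟩
  gcongr
  intro w hw
  change ChronologicalOutputs U c (appendTape i w) h
  rw [chronologicalOutputs_iff]
  intro g hg
  -- `Outputs` never holds for the empty string, but the empty output is there at the start. Percept
  -- strings can be empty even for nonempty `g`, since a codeword may be empty.
  by_cases hy : c.percepts g = []
  · rw [hy]
    exact ⟨_, [], [], List.nil_prefix, onTape_nil _, Reaches.start⟩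
  obtain ⟨s, x, n, hx, hr⟩ := hw g hg
  obtain ⟨x', p', hx', hp', ho⟩ := hr.exists_outputs hy
  obtain ⟨s', hr'⟩ := (((hi x' p').1 _).2 ho).exists_reaches
  exact ⟨s', x', i ++ p', hx'.trans hx,
    onTape_appendTape.2 ((onTape_tapePrefix w n).of_prefix hp'), hr'⟩

theorem measurableSet_chronologicalOutputs (U : MonotoneMachine) (c : HistoryCode A O R)
    (h : List (Step A O R)) : MeasurableSet {w | ChronologicalOutputs U c w h} := by
  have : {w | ChronologicalOutputs U c w h} = ⋂ g ∈ {g | g <+: h}, ⋃ p : List Bool,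
      ⋃ _ : ∃ s x, x <+: c.actions g ∧ U.Reaches s x p (c.percepts g), {w | OnTape w p} := by
    ext w
    simp only [Set.mem_ofPred_eq, chronologicalOutputs_iff, Set.mem_iInter, Set.mem_iUnion]
    refine forall₂_congr fun g _ => ⟨?_, ?_⟩
    · rintro ⟨s, x, p, hx, hp, hr⟩
      exact ⟨p, ⟨s, x, hx, hr⟩, hp⟩
    · rintro ⟨p, ⟨s, x, hx, hr⟩, hp⟩
      exact ⟨s, x, p, hx, hp, hr⟩
  rw [this]
  refine MeasurableSet.biInter ?_ fun g _ => MeasurableSet.iUnion fun p =>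
    MeasurableSet.iUnion fun _ => measurableSet_onTape p
  have : {g | g <+: h} = {g | g ∈ h.inits} := by ext g; simp
  rw [this]
  exact (List.finite_toSet h.inits).countable

theorem SelfDelimitingCode.injective {α : Type*} (d : SelfDelimitingCode α) :
    Function.Injective d.enc :=
  fun a b h => d.eq_of_prefix a b (h ▸ List.prefix_refl _)

theorem HistoryCode.actions_append (c : HistoryCode A O R) (g h : List (Step A O R)) :
    c.actions (g ++ h) = c.actions g ++ c.actions h := by
  simp [HistoryCode.actions]

theorem HistoryCode.percepts_append (c : HistoryCode A O R) (g h : List (Step A O R)) :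
    c.percepts (g ++ h) = c.percepts g ++ c.percepts h := by
  simp [HistoryCode.percepts]

/-- Words of two self-delimiting sets can be read off from the left. -/
theorem HistoryCode.percept_eq_of_prefix (c : HistoryCode A O R) {e f : O × R}
    (h : c.observation.enc e.1 ++ c.reward.enc e.2 <+: c.observation.enc f.1 ++ c.reward.enc f.2) :
    e = f := by
  have h₁ : c.observation.enc e.1 <+: c.observation.enc f.1 ++ c.reward.enc f.2 :=
    (List.prefix_append _ _).trans h
  have h₂ : e.1 = f.1 := by
    rcases List.prefix_or_prefix_of_prefix h₁ (List.prefix_append _ _) with h | h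
    · exact c.observation.eq_of_prefix _ _ h
    · exact (c.observation.eq_of_prefix _ _ h).symm
  rw [h₂, List.prefix_append_right_inj] at h
  exact Prod.ext h₂ (c.reward.eq_of_prefix _ _ h)

/-- Both outputs occur on one run, so one is a prefix of the other; self-delimitation then
identifies the percepts. -/
theorem ChronologicalOutputs.percept_unique {h : List (Step A O R)} {a : A} {e f : O × R}
    (he : ChronologicalOutputs U c w (h ++ [(a, e)]))
    (hf : ChronologicalOutputs U c w (h ++ [(a, f)])) : e = f := by
  rw [chronologicalOutputs_iff] at he hf
  obtain ⟨s, x, p, hx, hp, hr⟩ := he _ (List.prefix_refl _)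
  obtain ⟨s', x', p', hx', hp', hr'⟩ := hf _ (List.prefix_refl _)
  simp only [HistoryCode.percepts_append, HistoryCode.actions_append] at *
  rcases hr.leads_or_leads hr' hx hx' hp hp' with h | h
  · have := h.prefix.2.2
    rw [List.prefix_append_right_inj] at this
    exact c.percept_eq_of_prefix (by simpa [HistoryCode.percepts] using this)
  · have := h.prefix.2.2
    rw [List.prefix_append_right_inj] at this
    exact (c.percept_eq_of_prefix (by simpa [HistoryCode.percepts] using this)).symm

end Prior

/-! ### A machine that runs two programs -/

namespace MonotoneMachine

/-- A monotone machine whose states are coded elements of `σ`. -/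
def ofState {σ : Type*} [Primcodable σ] (start : σ) (op : σ → Op) (next : σ → Bool → σ)
    (hop : Computable op) (hnext : Computable₂ next) : MonotoneMachine where
  start := Encodable.encode start
  op n := ((Encodable.decode n).map op).getD .halt
  next n b := ((Encodable.decode n).map fun s => Encodable.encode (next s b)).getD 0
  op_computable := Computable.option_getD
    (Computable.option_map Computable.decode (hop.comp Computable.snd).to₂) (Computable.const _)
  next_computable := Computable.option_getD (Computable.option_map
    (Computable.decode.comp Computable.fst)
    (Computable.encode.comp
      (hnext.comp Computable.snd (Computable.snd.comp Computable.fst))).to₂) (Computable.const _)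

section ofState

variable {σ : Type*} [Primcodable σ] {start : σ} {op : σ → Op} {next : σ → Bool → σ}
  {hop : Computable op} {hnext : Computable₂ next}

theorem ofState_op (s : σ) :
    (ofState start op next hop hnext).op (Encodable.encode s) = op s := by
  simp [ofState]

theorem ofState_next (s : σ) (b : Bool) :
    (ofState start op next hop hnext).next (Encodable.encode s) b =
      Encodable.encode (next s b) := by
  simp [ofState]

end ofState

/-- The machine that writes `l` and halts. -/
def writer (l : List Bool) : MonotoneMachine :=
  ofState l (fun m => (m.head?.map Op.write).getD .halt) (fun m _ => m.tail)
    (Computable.option_getD (Computable.option_map Primrec.list_head?.to_comp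
      ((Primrec.dom_finite Op.write).to_comp.comp Computable.snd).to₂) (Computable.const _))
    (Primrec.list_tail.to_comp.comp Computable.fst).to₂

theorem writer_reaches (l y m : List Bool) (h : l = y ++ m) :
    (writer l).Reaches (Encodable.encode m) [] [] y := by
  induction y using List.reverseRecOn generalizing m with
  | nil => subst h; exact Reaches.start
  | append_singleton y b ih =>
    have := (ih (b :: m) (by simpa using h)).write (b := b) (ofState_op _)
    rwa [writer, ofState_next] at this

end MonotoneMachine

namespace Op

/-- The step is a halting step. -/
def isHalt : Op → Bool
  | .halt => true
  | _ => false

/-- The step reads a bit of the program. -/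
def isReadProgram : Op → Bool
  | .readProgram => true
  | _ => false

/-- The step reads a bit of the input. -/
def isReadInput : Op → Bool
  | .readInput => true
  | _ => false

/-- The step writes a bit. -/
def isWrite : Op → Bool
  | .write _ => true
  | _ => false

/-- The bit that is written. -/
def bit : Op → Bool
  | .write b => b
  | _ => false

theorem finite : Finite Op := Finite.of_equiv _ equivFin.symm

theorem computable_comp {α β : Type*} [Primcodable α] [Primcodable β] (f : Op → β) {g : α → Op}
    (hg : Computable g) : Computable fun a => f (g a) :=
  have := Op.finite
  (Primrec.dom_finite f).to_comp.comp hg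

end Op

/-- The memory of the machine `doom`: the state of the environment program, the number of bits that
it has read, and the actions that it has not read yet; the state of the stopping program and the
number of bits that it has read; the bits that have been read from the program tape; the number of
complete codewords in the history and what is there of the next codeword; the string that is written
after the stopping program has halted. -/
abbrev DoomState : Type :=
  (ℕ × ℕ × List Bool) × (ℕ × ℕ) × List Bool × (ℕ × List Bool) × List Bool

section DoomMachine

variable (U : MonotoneMachine) (code : ℕ → List Bool → Bool)

/-- The kind of the next step of `doom`. -/
def doomOp : DoomState → Op
  | ((u, m, _), (v, n), P, (j, t), d) =>
    bif (U.op v).isHalt then .write d.headI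
    else bif (U.op v).isReadProgram then
      -- Bit `n` of the stopping program is at position `2 * n + 1` of the shared tape. The buffer
      -- `P` is extended until it contains this position.
      bif decide (P.length ≤ 2 * n + 1) then .readProgram else .compute
    else bif (U.op v).isReadInput then
      bif code j t then .compute
      else bif j % 3 == 0 then .readInput
      else bif (U.op u).isReadProgram then
        bif decide (P.length ≤ 2 * m) then .readProgram else .compute
      -- The environment program reads from the queue `q` of action bits already passed to the
      -- stopping program, so the input head does not move.
      else bif (U.op u).isReadInput then .compute
      else U.op u
    else .compute

/-- The next state of `doom`. -/
def doomNext : DoomState → Bool → DoomState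
  | ((u, m, q), (v, n), P, (j, t), d), b =>
    -- The word is rotated rather than consumed: after `d.length` steps it is back in its original
    -- form and the next copy begins.
    bif (U.op v).isHalt then ((u, m, q), (v, n), P, (j, t), d.tail ++ [d.headI])
    else bif (U.op v).isReadProgram then
      bif decide (P.length ≤ 2 * n + 1) then ((u, m, q), (v, n), P ++ [b], (j, t), d)
      else ((u, m, q), (U.next v (P[2 * n + 1]?.getD false), n + 1), P, (j, t), d)
    else bif (U.op v).isReadInput then
      bif code j t then ((u, m, q), (v, n), P, (j + 1, []), d)
      else bif j % 3 == 0 then ((u, m, q ++ [b]), (U.next v b, n), P, (j, t ++ [b]), d)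
      else bif (U.op u).isReadProgram then
        bif decide (P.length ≤ 2 * m) then ((u, m, q), (v, n), P ++ [b], (j, t), d)
        else ((U.next u (P[2 * m]?.getD false), m + 1, q), (v, n), P, (j, t), d)
      else bif (U.op u).isReadInput then
        ((U.next u q.headI, m, q.tail), (v, n), P, (j, t), d)
      else bif (U.op u).isWrite then
        ((U.next u false, m, q), (U.next v (U.op u).bit, n), P, (j, t ++ [(U.op u).bit]), d)
      else ((U.next u false, m, q), (v, n), P, (j, t), d)
    else ((u, m, q), (U.next v false, n), P, (j, t), d)

/-! ### Computability of the transition functions -/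

section Computability

variable {α : Type*} [Primcodable α]

theorem computable_length_le_double {P : α → List Bool} {n : α → ℕ} (hP : Computable P)
    (hn : Computable n) (r : ℕ) : Computable fun a => decide ((P a).length ≤ 2 * n a + r) := by
  have : Primrec₂ fun (a b : ℕ) => decide (a ≤ 2 * b + r) :=
    (PrimrecRel.decide (Primrec.nat_le.comp Primrec.fst (Primrec.nat_add.comp
      (Primrec.nat_mul.comp (Primrec.const 2) Primrec.snd) (Primrec.const r))))
  exact this.to_comp.comp (Computable.list_length.comp hP) hn

theorem computable_getD_double {P : α → List Bool} {n : α → ℕ} (hP : Computable P)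
    (hn : Computable n) (r : ℕ) : Computable fun a => (P a)[2 * n a + r]?.getD false := by
  have : Primrec fun b : ℕ => 2 * b + r :=
    Primrec.nat_add.comp (Primrec.nat_mul.comp (Primrec.const 2) Primrec.id) (Primrec.const r)
  exact Computable.option_getD (Computable.list_getElem?.comp hP (this.to_comp.comp hn))
    (Computable.const _)

theorem computable_mod_three {j : α → ℕ} (hj : Computable j) :
    Computable fun a => (j a) % 3 == 0 := by
  have : Primrec fun b : ℕ => b % 3 == 0 :=
    Primrec.beq.comp (Primrec.nat_mod.comp Primrec.id (Primrec.const 3)) (Primrec.const 0)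
  exact this.to_comp.comp hj

end Computability

variable {U code}

theorem computable_doomOp (hcode : Computable₂ code) : Computable (doomOp U code) := by
  have hu : Computable fun s : DoomState => s.1.1 := Computable.fst.comp Computable.fst
  have hm : Computable fun s : DoomState => s.1.2.1 :=
    Computable.fst.comp (Computable.snd.comp Computable.fst)
  have hv : Computable fun s : DoomState => s.2.1.1 :=
    Computable.fst.comp (Computable.fst.comp Computable.snd)
  have hn : Computable fun s : DoomState => s.2.1.2 :=
    Computable.snd.comp (Computable.fst.comp Computable.snd)
  have hr : Computable fun s : DoomState => s.2.2 := Computable.snd.comp Computable.snd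
  have hP : Computable fun s : DoomState => s.2.2.1 := Computable.fst.comp hr
  have hj : Computable fun s : DoomState => s.2.2.2.1.1 :=
    Computable.fst.comp (Computable.fst.comp (Computable.snd.comp hr))
  have ht : Computable fun s : DoomState => s.2.2.2.1.2 :=
    Computable.snd.comp (Computable.fst.comp (Computable.snd.comp hr))
  have hd : Computable fun s : DoomState => s.2.2.2.2 :=
    Computable.snd.comp (Computable.snd.comp hr)
  have hou := U.op_computable.comp hu
  have hov := U.op_computable.comp hv
  have := Op.finite
  refine (Computable.cond (Op.computable_comp Op.isHalt hov)
    ((Primrec.dom_finite Op.write).to_comp.comp (Primrec.list_headI.to_comp.comp hd))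
    (Computable.cond (Op.computable_comp Op.isReadProgram hov)
      (Computable.cond (computable_length_le_double hP hn 1)
        (Computable.const .readProgram) (Computable.const .compute))
      (Computable.cond (Op.computable_comp Op.isReadInput hov)
        (Computable.cond (hcode.comp hj ht) (Computable.const .compute)
          (Computable.cond (computable_mod_three hj) (Computable.const .readInput)
            (Computable.cond (Op.computable_comp Op.isReadProgram hou)
              (Computable.cond (computable_length_le_double hP hm 0)
                (Computable.const .readProgram) (Computable.const .compute))
              (Computable.cond (Op.computable_comp Op.isReadInput hou)
                (Computable.const .compute) hou))))
        (Computable.const .compute)))).of_eq fun s => rfl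

theorem computable_doomNext (hcode : Computable₂ code) : Computable₂ (doomNext U code) := by
  have h₀ : Computable fun s : DoomState × Bool => s.1 := Computable.fst
  have hb : Computable fun s : DoomState × Bool => s.2 := Computable.snd
  have hU : Computable fun s : DoomState × Bool => s.1.1 := Computable.fst.comp h₀
  have hu : Computable fun s : DoomState × Bool => s.1.1.1 := Computable.fst.comp hU
  have hm : Computable fun s : DoomState × Bool => s.1.1.2.1 :=
    Computable.fst.comp (Computable.snd.comp hU)
  have hq : Computable fun s : DoomState × Bool => s.1.1.2.2 :=
    Computable.snd.comp (Computable.snd.comp hU)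
  have hV : Computable fun s : DoomState × Bool => s.1.2.1 :=
    Computable.fst.comp (Computable.snd.comp h₀)
  have hv : Computable fun s : DoomState × Bool => s.1.2.1.1 := Computable.fst.comp hV
  have hn : Computable fun s : DoomState × Bool => s.1.2.1.2 := Computable.snd.comp hV
  have hr : Computable fun s : DoomState × Bool => s.1.2.2 :=
    Computable.snd.comp (Computable.snd.comp h₀)
  have hP : Computable fun s : DoomState × Bool => s.1.2.2.1 := Computable.fst.comp hr
  have hJ : Computable fun s : DoomState × Bool => s.1.2.2.2.1 :=
    Computable.fst.comp (Computable.snd.comp hr)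
  have hj : Computable fun s : DoomState × Bool => s.1.2.2.2.1.1 := Computable.fst.comp hJ
  have ht : Computable fun s : DoomState × Bool => s.1.2.2.2.1.2 := Computable.snd.comp hJ
  have hd : Computable fun s : DoomState × Bool => s.1.2.2.2.2 :=
    Computable.snd.comp (Computable.snd.comp hr)
  have hou := U.op_computable.comp hu
  have hov := U.op_computable.comp hv
  have hfalse : Computable fun _ : DoomState × Bool => false := Computable.const false
  have hPb := hU.pair (hV.pair ((Computable.list_concat.comp hP hb).pair (hJ.pair hd)))
  have hbit := Op.computable_comp Op.bit hou
  refine (Computable.cond (Op.computable_comp Op.isHalt hov)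
    (hU.pair (hV.pair (hP.pair (hJ.pair (Computable.list_concat.comp
      (Primrec.list_tail.to_comp.comp hd) (Primrec.list_headI.to_comp.comp hd))))))
    (Computable.cond (Op.computable_comp Op.isReadProgram hov)
      (Computable.cond (computable_length_le_double hP hn 1) hPb
        (hU.pair (((U.next_computable.comp hv (computable_getD_double hP hn 1)).pair
          (Computable.succ.comp hn)).pair (hP.pair (hJ.pair hd)))))
      (Computable.cond (Op.computable_comp Op.isReadInput hov)
        (Computable.cond (hcode.comp hj ht)
          (hU.pair (hV.pair (hP.pair
            (((Computable.succ.comp hj).pair (Computable.const [])).pair hd))))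
          (Computable.cond (computable_mod_three hj)
            ((hu.pair (hm.pair (Computable.list_concat.comp hq hb))).pair
              (((U.next_computable.comp hv hb).pair hn).pair
                (hP.pair ((hj.pair (Computable.list_concat.comp ht hb)).pair hd))))
            (Computable.cond (Op.computable_comp Op.isReadProgram hou)
              (Computable.cond (computable_length_le_double hP hm 0) hPb
                (((U.next_computable.comp hu (computable_getD_double hP hm 0)).pair
                  ((Computable.succ.comp hm).pair hq)).pair
                    (hV.pair (hP.pair (hJ.pair hd)))))
              (Computable.cond (Op.computable_comp Op.isReadInput hou)
                (((U.next_computable.comp hu (Primrec.list_headI.to_comp.comp hq)).pair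
                  (hm.pair (Primrec.list_tail.to_comp.comp hq))).pair
                    (hV.pair (hP.pair (hJ.pair hd))))
                (Computable.cond (Op.computable_comp Op.isWrite hou)
                  (((U.next_computable.comp hu hfalse).pair (hm.pair hq)).pair
                    (((U.next_computable.comp hv hbit).pair hn).pair
                      (hP.pair ((hj.pair (Computable.list_concat.comp ht hbit)).pair hd))))
                  (((U.next_computable.comp hu hfalse).pair (hm.pair hq)).pair
                    (hV.pair (hP.pair (hJ.pair hd)))))))))
        (hU.pair (((U.next_computable.comp hv hfalse).pair hn).pair
          (hP.pair (hJ.pair hd))))))).of_eq fun s => rfl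

variable (U) in
/-- The machine that runs an environment program (on the even bits of its program tape) and answers
the actions by its percepts, and runs a stopping program (on the odd bits) on the history that
arises in this way; when the stopping program halts, the machine writes `d` again and again. -/
def doom (hcode : Computable₂ code) (d : List Bool) : MonotoneMachine :=
  ofState (((U.start, 0, []), (U.start, 0), [], (0, []), d) : DoomState) (doomOp U code)
    (doomNext U code) (computable_doomOp hcode) (computable_doomNext hcode)

end DoomMachine

/-! ### The run of the machine `doom` -/

/-- The concatenation of the input words (those with positions divisible by three) of a list of
words whose first position is `j`. -/
def inputPart : ℕ → List (List Bool) → List Bool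
  | _, [] => []
  | j, w :: W => (if j % 3 = 0 then w else []) ++ inputPart (j + 1) W

/-- The concatenation of the output words (those with positions not divisible by three) of a list of
words whose first position is `j`. -/
def outputPart : ℕ → List (List Bool) → List Bool
  | _, [] => []
  | j, w :: W => (if j % 3 = 0 then [] else w) ++ outputPart (j + 1) W

/-- Every word is accepted by `code` at its position, and no proper initial part of it is. -/
def IsCoded (code : ℕ → List Bool → Bool) : ℕ → List (List Bool) → Prop
  | _, [] => True
  | j, w :: W => (code j w = true ∧ ∀ t, t <+: w → code j t = true → t = w) ∧
      IsCoded code (j + 1) W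

theorem inputPart_append (j : ℕ) (V W : List (List Bool)) :
    inputPart j (V ++ W) = inputPart j V ++ inputPart (j + V.length) W := by
  induction V generalizing j with
  | nil => rfl
  | cons v V ih => simp [inputPart, ih, Nat.add_assoc, Nat.add_comm 1]

theorem outputPart_append (j : ℕ) (V W : List (List Bool)) :
    outputPart j (V ++ W) = outputPart j V ++ outputPart (j + V.length) W := by
  induction V generalizing j with
  | nil => rfl
  | cons v V ih => simp [outputPart, ih, Nat.add_assoc, Nat.add_comm 1]

theorem isCoded_append {code : ℕ → List Bool → Bool} {j : ℕ} {V W : List (List Bool)} :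
    IsCoded code j (V ++ W) ↔ IsCoded code j V ∧ IsCoded code (j + V.length) W := by
  induction V generalizing j with
  | nil => simp [IsCoded]
  | cons v V ih => simp [IsCoded, ih, Nat.add_assoc, Nat.add_comm 1, and_assoc]

theorem inputPart_concat (V : List (List Bool)) (t : List Bool) :
    inputPart 0 (V ++ [t]) = inputPart 0 V ++ if V.length % 3 = 0 then t else [] := by
  simp [inputPart_append, inputPart]

theorem outputPart_concat (V : List (List Bool)) (t : List Bool) :
    outputPart 0 (V ++ [t]) = outputPart 0 V ++ if V.length % 3 = 0 then [] else t := by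
  simp [outputPart_append, outputPart]

/-- A prefix-free set may consist of the empty word alone, so trailing words can be invisible in the
concatenated history. -/
theorem parts_of_flatten_eq_nil {j : ℕ} {W : List (List Bool)} (h : W.flatten = []) :
    inputPart j W = [] ∧ outputPart j W = [] := by
  induction W generalizing j with
  | nil => exact ⟨rfl, rfl⟩
  | cons w W ih =>
    simp only [List.flatten_cons, List.append_eq_nil_iff] at h
    obtain ⟨h₁, h₂⟩ := ih (j := j + 1) h.2
    simp [inputPart, outputPart, h.1, h₁, h₂]

section Doom

variable {U : MonotoneMachine} {code : ℕ → List Bool → Bool} {hcode : Computable₂ code}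
  {d₀ : List Bool}

theorem doom_op (s : DoomState) :
    (doom U hcode d₀).op (Encodable.encode s) = doomOp U code s := ofState_op s

theorem doom_next (s : DoomState) (b : Bool) :
    (doom U hcode d₀).next (Encodable.encode s) b = Encodable.encode (doomNext U code s b) :=
  ofState_next s b

/-- `doom` arrives at the memory contents `s` after it has read `x` and a part of the program
tape `w`, and has written `y`. -/
def DoomReaches (hcode : Computable₂ code) (d₀ : List Bool) (w : ℕ → Bool)
    (s : DoomState) (x y : List Bool) : Prop :=
  (doom U hcode d₀).Reaches (Encodable.encode s) x s.2.2.1 y ∧ OnTape w s.2.2.1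

variable {w : ℕ → Bool} {s : DoomState} {x y : List Bool}

theorem DoomReaches.compute {s' : DoomState} (h : DoomReaches (U := U) hcode d₀ w s x y)
    (hs : doomOp U code s = .compute) (hs' : doomNext U code s false = s')
    (hP : s'.2.2.1 = s.2.2.1) : DoomReaches (U := U) hcode d₀ w s' x y := by
  have := h.1.compute ((doom_op s).trans hs)
  rw [doom_next, hs', ← hP] at this
  exact ⟨this, hP ▸ h.2⟩

theorem DoomReaches.write {s' : DoomState} {b : Bool} (h : DoomReaches (U := U) hcode d₀ w s x y)
    (hs : doomOp U code s = .write b) (hs' : doomNext U code s false = s')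
    (hP : s'.2.2.1 = s.2.2.1) : DoomReaches (U := U) hcode d₀ w s' x (y ++ [b]) := by
  have := h.1.write ((doom_op s).trans hs)
  rw [doom_next, hs', ← hP] at this
  exact ⟨this, hP ▸ h.2⟩

theorem DoomReaches.readInput {s' : DoomState} (b : Bool)
    (h : DoomReaches (U := U) hcode d₀ w s x y)
    (hs : doomOp U code s = .readInput) (hs' : doomNext U code s b = s')
    (hP : s'.2.2.1 = s.2.2.1) : DoomReaches (U := U) hcode d₀ w s' (x ++ [b]) y := by
  have := h.1.readInput b ((doom_op s).trans hs)
  rw [doom_next, hs', ← hP] at this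
  exact ⟨this, hP ▸ h.2⟩

theorem DoomReaches.readProgram {s' : DoomState} (h : DoomReaches (U := U) hcode d₀ w s x y)
    (hs : doomOp U code s = .readProgram)
    (hs' : doomNext U code s (w s.2.2.1.length) = s')
    (hP : s'.2.2.1 = s.2.2.1 ++ [w s.2.2.1.length]) :
    DoomReaches (U := U) hcode d₀ w s' x y := by
  have := h.1.readProgram (w s.2.2.1.length) ((doom_op s).trans hs)
  rw [doom_next, hs', ← hP] at this
  exact ⟨this, hP ▸ onTape_concat.2 ⟨h.2, rfl⟩⟩

variable {u m v n j : ℕ} {q P t d : List Bool} {w₁ w₂ : ℕ → Bool}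

theorem getD_of_onTape (hP : OnTape w P) {i : ℕ} (hi : i < P.length) :
    P[i]?.getD false = w i := by
  rw [onTape_iff] at hP
  rw [List.getElem?_eq_getElem hi, Option.getD_some, hP i hi]

/-- The stopping program reads a bit of its program tape. -/
theorem DoomReaches.stopping_readProgram (hs : U.op v = .readProgram)
    (h : DoomReaches (U := U) hcode d₀ (interleave (w₁, w₂))
      ((u, m, q), (v, n), P, (j, t), d) x y) :
    ∃ P', DoomReaches (U := U) hcode d₀ (interleave (w₁, w₂))
      ((u, m, q), (U.next v (w₂ n), n + 1), P', (j, t), d) x y := by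
  -- Induction on the number of tape bits still missing from the buffer.
  induction hk : 2 * n + 2 - P.length generalizing P with
  | zero =>
    have hlt : 2 * n + 1 < P.length := by omega
    refine ⟨P, h.compute ?_ ?_ rfl⟩
    · simp [doomOp, hs, Op.isHalt, Op.isReadProgram, hlt.not_ge]
    · simp only [doomNext, hs, Op.isHalt, Op.isReadProgram, hlt.not_ge, decide_false, cond_false,
        cond_true]
      rw [getD_of_onTape h.2 hlt, interleave_odd]
  | succ k ih =>
    have hle : P.length ≤ 2 * n + 1 := by omega
    refine ih (h.readProgram ?_ ?_ rfl) ?_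
    · simp [doomOp, hs, Op.isHalt, Op.isReadProgram, hle]
    · simp [doomNext, hs, Op.isHalt, Op.isReadProgram, hle]
    · change _ - (P ++ [_]).length = k
      rw [List.length_append, List.length_singleton]; omega

/-- The environment program reads a bit of its program tape. -/
theorem DoomReaches.environment_readProgram (hs : U.op v = .readInput) (ht : code j t = false)
    (hj : j % 3 ≠ 0) (hu : U.op u = .readProgram)
    (h : DoomReaches (U := U) hcode d₀ (interleave (w₁, w₂))
      ((u, m, q), (v, n), P, (j, t), d) x y) :
    ∃ P', DoomReaches (U := U) hcode d₀ (interleave (w₁, w₂))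
      ((U.next u (w₁ m), m + 1, q), (v, n), P', (j, t), d) x y := by
  have hj' : (j % 3 == 0) = false := beq_eq_false_iff_ne.2 hj
  induction hk : 2 * m + 1 - P.length generalizing P with
  | zero =>
    have hlt : 2 * m < P.length := by omega
    refine ⟨P, h.compute ?_ ?_ rfl⟩
    · simp [doomOp, hs, hu, ht, hj', Op.isHalt, Op.isReadProgram, Op.isReadInput, hlt.not_ge]
    · simp only [doomNext, hs, hu, ht, hj', Op.isHalt, Op.isReadProgram,
        Op.isReadInput, hlt.not_ge, decide_false, cond_false, cond_true]
      rw [getD_of_onTape h.2 hlt, interleave_even]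
  | succ k ih =>
    have hle : P.length ≤ 2 * m := by omega
    refine ih (h.readProgram ?_ ?_ rfl) ?_
    · simp [doomOp, hs, hu, ht, hj', Op.isHalt, Op.isReadProgram, Op.isReadInput, hle]
    · simp [doomNext, hs, hu, ht, hj', Op.isHalt, Op.isReadProgram, Op.isReadInput, hle]
    · change _ - (P ++ [_]).length = k
      rw [List.length_append, List.length_singleton]; omega

/-- The environment program runs until it has written the next bit of the history. -/
theorem DoomReaches.environment_write {X : List Bool} {b : Bool} {k l : Config}
    (hkl : U.Leads X w₁ k l) (hs : U.op v = .readInput) (ht : code j t = false)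
    (hj : j % 3 ≠ 0) (hl : k.output ++ [b] <+: l.output) (hq : k.input ++ q = X)
    (hr : U.Reaches k.state k.input k.program k.output) (hk : OnTape w₁ k.program)
    (h : DoomReaches (U := U) hcode d₀ (interleave (w₁, w₂))
      ((k.state, k.program.length, q), (v, n), P, (j, t), d) x y) :
    ∃ u' p' q' P' x', x' ++ q' = X ∧ U.Reaches u' x' p' (k.output ++ [b]) ∧ OnTape w₁ p' ∧
      DoomReaches (U := U) hcode d₀ (interleave (w₁, w₂))
        ((u', p'.length, q'), (U.next v b, n), P', (j, t ++ [b]), d) x (y ++ [b]) := by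
  have hj' : (j % 3 == 0) = false := beq_eq_false_iff_ne.2 hj
  induction hkl using Relation.ReflTransGen.head_induction_on generalizing q P with
  | refl => exact absurd hl.length_le (by simp)
  | @head k k' hstep hrest ih =>
    unfold TapeStep at hstep
    cases hu : U.op k.state <;> simp only [hu] at hstep
    · subst hstep
      refine ih hl hq (hr.compute hu) hk (h.compute ?_ ?_ rfl)
      · simp [doomOp, hs, hu, ht, hj', Op.isHalt, Op.isReadProgram, Op.isReadInput]
      · simp [doomNext, hs, hu, ht, hj', Op.isHalt, Op.isReadProgram, Op.isReadInput, Op.isWrite]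
    · obtain ⟨e, he, rfl⟩ := hstep
      -- The bit that the environment program reads is the next one of `X`, hence the head of the
      -- queue; in particular the queue is not empty.
      rw [← hq, List.prefix_append_right_inj] at he
      obtain ⟨q, rfl⟩ := he
      refine ih hl (by simpa using hq) (hr.readInput e hu) hk (h.compute ?_ ?_ rfl)
      · simp [doomOp, hs, hu, ht, hj', Op.isHalt, Op.isReadProgram, Op.isReadInput]
      · simp [doomNext, hs, hu, ht, hj', Op.isHalt, Op.isReadProgram, Op.isReadInput]
    · subst hstep
      obtain ⟨P', hP'⟩ := h.environment_readProgram hs ht hj hu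
      refine ih hl hq (hr.readProgram _ hu) (onTape_concat.2 ⟨hk, rfl⟩) (P := P') ?_
      simpa using hP'
    · rename_i e
      subst hstep
      -- Output only grows along the run, so the bit written now must agree with the output of `l`.
      obtain rfl : b = e := by
        have hl' : k.output ++ [e] <+: l.output := (Leads.prefix hrest).2.2
        have := (List.prefix_of_prefix_length_le hl hl' (by simp)).eq_of_length (by simp)
        simpa using this
      refine ⟨_, _, q, P, _, hq, hr.write hu, hk, h.write ?_ ?_ rfl⟩
      · simp [doomOp, hs, hu, ht, hj', Op.isHalt, Op.isReadProgram, Op.isReadInput]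
      · simp [doomNext, hs, hu, ht, hj', Op.isHalt, Op.isReadProgram, Op.isReadInput, Op.isWrite,
          Op.bit]

/-- After the stopping program has halted, the string `d` is written. -/
theorem DoomReaches.write_word (hs : U.op v = .halt) (e : List Bool)
    (h : DoomReaches (U := U) hcode d₀ w ((u, m, q), (v, n), P, (j, t), d ++ e) x y) :
    DoomReaches (U := U) hcode d₀ w ((u, m, q), (v, n), P, (j, t), e ++ d) x (y ++ d) := by
  induction d generalizing e y with
  | nil => simpa using h
  | cons b d ih =>
    have := ih (e ++ [b]) (y := y ++ [b]) <| by
      refine h.write (b := b) ?_ ?_ rfl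
      · simp [doomOp, hs, Op.isHalt]
      · simp [doomNext, hs, Op.isHalt]
    simpa using this

/-- One full rotation restores the memory, so the writing can be repeated. -/
theorem DoomReaches.write_words (hs : U.op v = .halt)
    (h : DoomReaches (U := U) hcode d₀ w ((u, m, q), (v, n), P, (j, t), d) x y) (k : ℕ) :
    DoomReaches (U := U) hcode d₀ w ((u, m, q), (v, n), P, (j, t), d) x
      (y ++ (List.replicate k d).flatten) := by
  induction k with
  | zero => simpa using h
  | succ k ih =>
    have := DoomReaches.write_word hs [] (d := d) (by simpa using ih)
    rw [List.replicate_succ', List.flatten_append]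
    simpa using this

variable {W : List (List Bool)}

variable (hcode d₀) in
/-- `doom` has processed the part `z` of the history while the stopping program is in state `v` and
has read `n` bits. -/
def DoomAt (U : MonotoneMachine) (w₁ w₂ : ℕ → Bool) (W : List (List Bool)) (v n : ℕ)
    (z : List Bool) : Prop :=
  ∃ V R t u x p q P, W = V ++ R ∧ t <+: R.headI ∧ z = V.flatten ++ t ∧
    -- The queue `q` is what `doom` has read of the actions and the environment program has not. The
    -- last clause of the definition keeps the earlier moments at which the outputs of initial parts
    -- of `V` were complete, as the timing condition requires.
    x ++ q = inputPart 0 (V ++ [t]) ∧ OnTape w₁ p ∧ U.Reaches u x p (outputPart 0 (V ++ [t])) ∧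
    DoomReaches (U := U) hcode d₀ (interleave (w₁, w₂))
      ((u, p.length, q), (v, n), P, (V.length, t), d₀) (inputPart 0 (V ++ [t]))
      (outputPart 0 (V ++ [t])) ∧
    ∀ V', V' <+: V → ∃ s x, x <+: inputPart 0 V' ∧
      DoomReaches (U := U) hcode d₀ (interleave (w₁, w₂)) s x (outputPart 0 V')

variable (U) in
/-- On the program tape `w`, the machine `U` writes every output word of `W` without reading an
input word after it. -/
def AnswersWords (w : ℕ → Bool) (W : List (List Bool)) : Prop :=
  ∀ V r R, W = V ++ r :: R → V.length % 3 ≠ 0 → ∃ s x p y, x <+: inputPart 0 V ∧ OnTape w p ∧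
    U.Reaches s x p y ∧ outputPart 0 (V ++ [r]) <+: y

/-- The stopping program asks for one more bit. Completed words are passed over first, by induction
on the remaining words, since several may be empty. Then the bit is read from the input tape if the
current word is an action; otherwise the environment program is run until it writes it. -/
theorem DoomAt.feed (hW : IsCoded code 0 W) (hans : AnswersWords U w₁ W) {z : List Bool}
    {b : Bool} (hs : U.op v = .readInput) (hz : z ++ [b] <+: W.flatten)
    (h : DoomAt hcode d₀ U w₁ w₂ W v n z) :
    DoomAt hcode d₀ U w₁ w₂ W (U.next v b) n (z ++ [b]) := by
  obtain ⟨V, R, t, u, x, p, q, P, rfl, ht, rfl, hq, hp, hr, hd, hrec⟩ := h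
  induction R generalizing V t P with
  | nil =>
    simp only [List.headI_nil] at ht
    obtain rfl : t = [] := List.prefix_nil.1 ht
    exact absurd hz.length_le (by simp)
  | cons r R ih =>
    rw [List.headI_cons] at ht
    have hr' := (isCoded_append.1 hW).2
    rw [Nat.zero_add, IsCoded] at hr'
    by_cases htr : t = r
    · subst htr
      have hd' : DoomReaches (U := U) hcode d₀ (interleave (w₁, w₂))
          ((u, p.length, q), (v, n), P, (V.length + 1, []), d₀) (inputPart 0 (V ++ [t]))
          (outputPart 0 (V ++ [t])) := by
        refine hd.compute ?_ ?_ rfl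
        · simp [doomOp, hs, hr'.1.1, Op.isHalt, Op.isReadProgram, Op.isReadInput]
        · simp [doomNext, hs, hr'.1.1, Op.isHalt, Op.isReadProgram, Op.isReadInput]
      have hi : inputPart 0 (V ++ [t] ++ [[]]) = inputPart 0 (V ++ [t]) := by
        rw [inputPart_concat (V ++ [t])]; simp
      have ho : outputPart 0 (V ++ [t] ++ [[]]) = outputPart 0 (V ++ [t]) := by
        rw [outputPart_concat (V ++ [t])]; simp
      have hW' : V ++ t :: R = V ++ [t] ++ R := by simp
      have := ih (V ++ [t]) [] P (hW' ▸ hW) (hW' ▸ hans) List.nil_prefix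
        (by simpa using hz) (hi.symm ▸ hq) (ho.symm ▸ hr)
        (by rw [hi, ho, List.length_append]; exact hd')
        (fun V' hV' => by
          rcases List.prefix_concat_iff.1 hV' with rfl | hV'
          · exact ⟨_, _, List.prefix_refl _, hd⟩
          · exact hrec V' hV')
      rw [← hW'] at this
      simpa using this
    -- A proper prefix of a codeword is not a codeword, so `doom` does not end the word too early.
    have hcd : code V.length t = false := by
      rw [← Bool.not_eq_true]
      exact fun h => htr (hr'.1.2 t ht h)
    have htb : t ++ [b] <+: r := by
      simp only [List.flatten_append, List.flatten_cons, List.append_assoc,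
        List.prefix_append_right_inj] at hz
      refine List.prefix_of_prefix_length_le hz (List.prefix_append _ _) ?_
      have : t.length ≠ r.length := fun h => htr (ht.eq_of_length h)
      have := ht.length_le
      rw [List.length_append, List.length_singleton]
      omega
    by_cases hj : V.length % 3 = 0
    · have hi : inputPart 0 (V ++ [t ++ [b]]) = inputPart 0 (V ++ [t]) ++ [b] := by
        simp [inputPart_concat, hj]
      have ho : outputPart 0 (V ++ [t ++ [b]]) = outputPart 0 (V ++ [t]) := by
        simp [outputPart_concat, hj]
      refine ⟨V, r :: R, t ++ [b], u, x, p, q ++ [b], P, rfl, htb, by simp, ?_, hp, ho ▸ hr, ?_,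
        hrec⟩
      · rw [hi, ← hq, List.append_assoc]
      · rw [hi, ho]
        refine hd.readInput b ?_ ?_ rfl
        · simp [doomOp, hs, hcd, hj, Op.isHalt, Op.isReadProgram, Op.isReadInput]
        · simp [doomNext, hs, hcd, hj, Op.isHalt, Op.isReadProgram, Op.isReadInput]
    · have hi (t) : inputPart 0 (V ++ [t]) = inputPart 0 V := by
        simp [inputPart_concat, hj]
      have ho : outputPart 0 (V ++ [t ++ [b]]) = outputPart 0 (V ++ [t]) ++ [b] := by
        simp [outputPart_concat, hj]
      obtain ⟨s', x', p', y', hx', hp', hr'', hy'⟩ := hans V r R rfl hj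
      have hyb : outputPart 0 (V ++ [t]) ++ [b] <+: y' := by
        refine List.IsPrefix.trans ?_ hy'
        rw [← ho]
        simpa [outputPart_concat, hj] using htb
      have hlead : U.Leads (inputPart 0 V) w₁ ⟨u, x, p, outputPart 0 (V ++ [t])⟩
          ⟨s', x', p', y'⟩ := by
        -- The moment promised by `AnswersWords` cannot be earlier, since more has been written by
        -- then.
        refine (hr.leads_or_leads hr'' ?_ hx' hp hp').resolve_right fun h => ?_
        · rw [← hi t, ← hq]
          exact List.prefix_append _ _
        · have := hyb.length_le.trans (Leads.prefix h).2.2.length_le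
          simp at this
      obtain ⟨u₁, p₁, q₁, P₁, x₁, hq₁, hr₁, hp₁, hd₁⟩ :=
        DoomReaches.environment_write hlead hs hcd hj hyb (by rw [hq, hi]) hr hp hd
      refine ⟨V, r :: R, t ++ [b], u₁, x₁, p₁, q₁, P₁, rfl, htb, by simp, ?_, hp₁, ?_, ?_, hrec⟩
      · rw [hi, hq₁]
      · rw [ho]; exact hr₁
      · rw [ho, hi]
        rw [hi] at hd₁
        exact hd₁

/-- `doom` follows the run of the stopping program step by step; what that program writes is
discarded. -/
theorem DoomAt.of_reaches (hW : IsCoded code 0 W) (hans : AnswersWords U w₁ W)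
    {z p y : List Bool} (h : U.Reaches v z p y) (hz : z <+: W.flatten) (hp : OnTape w₂ p) :
    DoomAt hcode d₀ U w₁ w₂ W v p.length z := by
  induction h with
  | start =>
    refine ⟨[], W, [], U.start, [], [], [], [], rfl, List.nil_prefix, rfl, rfl, onTape_nil _,
      Reaches.start, ⟨Reaches.start, onTape_nil _⟩, fun V' hV' => ?_⟩
    obtain rfl := List.prefix_nil.1 hV'
    exact ⟨_, [], List.nil_prefix, Reaches.start, onTape_nil _⟩
  | compute _ hs ih =>
    obtain ⟨V, R, t, u, x, p, q, P, hV, ht, hzt, hq, hp', hr, hd, hrec⟩ := ih hz hp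
    refine ⟨V, R, t, u, x, p, q, P, hV, ht, hzt, hq, hp', hr, hd.compute ?_ ?_ rfl, hrec⟩
    · simp [doomOp, hs, Op.isHalt, Op.isReadProgram, Op.isReadInput]
    · simp [doomNext, hs, Op.isHalt, Op.isReadProgram, Op.isReadInput]
  | readInput b _ hs ih =>
    exact (ih ((List.prefix_append _ _).trans hz) hp).feed hW hans hs hz
  | readProgram b _ hs ih =>
    obtain ⟨hp₀, rfl⟩ := onTape_concat.1 hp
    obtain ⟨V, R, t, u, x, p, q, P, hV, ht, hzt, hq, hp', hr, hd, hrec⟩ := ih hz hp₀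
    obtain ⟨P', hP'⟩ := hd.stopping_readProgram hs
    rw [List.length_append]
    exact ⟨V, R, t, u, x, p, q, P', hV, ht, hzt, hq, hp', hr, hP', hrec⟩
  | write _ hs ih =>
    obtain ⟨V, R, t, u, x, p, q, P, hV, ht, hzt, hq, hp', hr, hd, hrec⟩ := ih hz hp
    refine ⟨V, R, t, u, x, p, q, P, hV, ht, hzt, hq, hp', hr, hd.compute ?_ ?_ rfl, hrec⟩
    · simp [doomOp, hs, Op.isHalt, Op.isReadProgram, Op.isReadInput]
    · simp [doomNext, hs, Op.isHalt, Op.isReadProgram, Op.isReadInput]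

/-- If the environment program answers the words `W` and the stopping program halts on them, then
`doom` answers the words `W` and goes on with any number of copies of `d₀`. -/
theorem doom_answers (hW : IsCoded code 0 W) (hans : AnswersWords U w₁ W) {p : List Bool}
    (hp : OnTape w₂ p) (h : U.Halts W.flatten p) :
    (∀ V, V <+: W → ∃ s x P, x <+: inputPart 0 V ∧ OnTape (interleave (w₁, w₂)) P ∧
      (doom U hcode d₀).Reaches s x P (outputPart 0 V)) ∧
    ∀ k : ℕ, ∃ s P, OnTape (interleave (w₁, w₂)) P ∧
      (doom U hcode d₀).Reaches s (inputPart 0 W) P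
        (outputPart 0 W ++ (List.replicate k d₀).flatten) := by
  obtain ⟨v, y, hr, hs⟩ := h
  obtain ⟨V, R, t, u, x, p, q, P, rfl, ht, hz, -, -, -, hd, hrec⟩ :=
    DoomAt.of_reaches (hcode := hcode) (d₀ := d₀) hW hans hr (List.prefix_refl _) hp
  -- When the stopping program halts, `doom` may not have passed the last words. But everything has
  -- been read, so `t` is a whole word and the words after it are empty; longer initial parts have
  -- the same inputs and outputs.
  have key : ∀ V', V' <+: V ++ R → ¬ V' <+: V →
      inputPart 0 V' = inputPart 0 (V ++ [t]) ∧ outputPart 0 V' = outputPart 0 (V ++ [t]) := by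
    intro V' hV' hVV'
    have hle := (List.prefix_or_prefix_of_prefix hV' (List.prefix_append V R)).resolve_left hVV'
    obtain ⟨S, rfl⟩ := hle
    rw [List.prefix_append_right_inj] at hV'
    obtain ⟨S', rfl⟩ := hV'
    cases S with
    | nil => simp at hVV'
    | cons r S =>
      rw [List.cons_append, List.headI_cons] at ht
      simp only [List.flatten_append, List.flatten_cons, List.append_cancel_left_eq,
        List.cons_append] at hz
      have hlen := congrArg List.length hz
      simp only [List.length_append] at hlen
      have hle := ht.length_le
      obtain rfl : t = r := ht.eq_of_length (by omega)
      have hS : S.flatten = [] := List.eq_nil_of_length_eq_zero (by omega)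
      have hVS : V ++ t :: S = V ++ [t] ++ S := by simp
      obtain ⟨h₁, h₂⟩ := parts_of_flatten_eq_nil (j := 0 + (V ++ [t]).length) hS
      rw [hVS, inputPart_append, outputPart_append _ _ S, h₁, h₂]
      simp
  refine ⟨fun V' hV' => ?_, fun k => ?_⟩
  · by_cases hVV' : V' <+: V
    · obtain ⟨s, x, hx, hs⟩ := hrec V' hVV'
      exact ⟨_, x, _, hx, hs.2, hs.1⟩
    · obtain ⟨h₁, h₂⟩ := key V' hV' hVV'
      rw [h₁, h₂]
      exact ⟨_, _, _, List.prefix_refl _, hd.2, hd.1⟩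
  · have h' : inputPart 0 (V ++ R) = inputPart 0 (V ++ [t]) ∧
        outputPart 0 (V ++ R) = outputPart 0 (V ++ [t]) := by
      by_cases hVV' : V ++ R <+: V
      · have : R = [] := List.eq_nil_of_length_eq_zero
          (by have := hVV'.length_le; rw [List.length_append] at this; omega)
        subst this
        obtain rfl : t = [] := List.prefix_nil.1 ht
        simp [inputPart_concat, outputPart_concat]
      · exact key _ (List.prefix_refl _) hVV'
    rw [h'.1, h'.2]
    have := hd.write_words hs k
    exact ⟨_, _, this.2, this.1⟩

end Doom

/-! ### The universal prior of histories that continue with the minimal reward -/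

theorem inputPart_add_three (j : ℕ) (W : List (List Bool)) :
    inputPart (j + 3) W = inputPart j W := by
  induction W generalizing j with
  | nil => rfl
  | cons w W ih => rw [inputPart, inputPart, Nat.add_right_comm, ih, Nat.add_mod_right]

theorem outputPart_add_three (j : ℕ) (W : List (List Bool)) :
    outputPart (j + 3) W = outputPart j W := by
  induction W generalizing j with
  | nil => rfl
  | cons w W ih => rw [outputPart, outputPart, Nat.add_right_comm, ih, Nat.add_mod_right]

theorem isCoded_add_three {code : ℕ → List Bool → Bool} (hc : ∀ j, code (j + 3) = code j) (j : ℕ)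
    (W : List (List Bool)) : IsCoded code (j + 3) W ↔ IsCoded code j W := by
  induction W generalizing j with
  | nil => rfl
  | cons w W ih => rw [IsCoded, IsCoded, Nat.add_right_comm, ih, hc]

namespace HistoryCode

variable {A O R : Type*} (c : HistoryCode A O R)

/-- The list of the codewords of a history. -/
def words (h : List (Step A O R)) : List (List Bool) :=
  h.flatMap fun e => [c.action.enc e.1, c.observation.enc e.2.1, c.reward.enc e.2.2]

theorem words_cons (e : Step A O R) (h : List (Step A O R)) :
    c.words (e :: h) = c.action.enc e.1 :: c.observation.enc e.2.1 :: c.reward.enc e.2.2 ::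
      c.words h := rfl

theorem words_append (g h : List (Step A O R)) : c.words (g ++ h) = c.words g ++ c.words h := by
  simp [words]

theorem length_words (h : List (Step A O R)) : (c.words h).length = 3 * h.length := by
  induction h with
  | nil => rfl
  | cons e h ih => rw [words_cons]; simp [ih]; omega

theorem flatten_words (h : List (Step A O R)) : (c.words h).flatten = c.history h := by
  induction h with
  | nil => rfl
  | cons e h ih => rw [words_cons]; simp [ih, history]

theorem inputPart_words (h : List (Step A O R)) : inputPart 0 (c.words h) = c.actions h := by
  induction h with
  | nil => rfl
  | cons e h ih =>
    rw [words_cons]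
    simp [inputPart, inputPart_add_three 0, ih, actions]

theorem outputPart_words (h : List (Step A O R)) : outputPart 0 (c.words h) = c.percepts h := by
  induction h with
  | nil => rfl
  | cons e h ih =>
    rw [words_cons]
    simp [outputPart, outputPart_add_three 0, ih, percepts]

theorem isCoded_words {code : ℕ → List Bool → Bool} (hc : ∀ j, code (j + 3) = code j)
    (ha : ∀ t, code 0 t = true ↔ t ∈ Set.range c.action.enc)
    (ho : ∀ t, code 1 t = true ↔ t ∈ Set.range c.observation.enc)
    (hr : ∀ t, code 2 t = true ↔ t ∈ Set.range c.reward.enc)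
    (h : List (Step A O R)) : IsCoded code 0 (c.words h) := by
  induction h with
  | nil => exact trivial
  | cons e h ih =>
    rw [words_cons]
    refine ⟨⟨(ha _).2 ⟨_, rfl⟩, fun t ht h => ?_⟩, ⟨(ho _).2 ⟨_, rfl⟩, fun t ht h => ?_⟩,
      ⟨(hr _).2 ⟨_, rfl⟩, fun t ht h => ?_⟩, (isCoded_add_three hc 0 _).2 ih⟩
    · rw [ha] at h
      obtain ⟨y, rfl⟩ := h
      rw [c.action.eq_of_prefix y _ ht]
    · rw [ho] at h
      obtain ⟨y, rfl⟩ := h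
      rw [c.observation.eq_of_prefix y _ ht]
    · rw [hr] at h
      obtain ⟨y, rfl⟩ := h
      rw [c.reward.eq_of_prefix y _ ht]

/-- Codewords of actions, observations and rewards at the positions `0`, `1` and `2` modulo three
can be recognized. -/
theorem exists_code : ∃ code : ℕ → List Bool → Bool, Computable₂ code ∧
    (∀ j, code (j + 3) = code j) ∧
    (∀ t, code 0 t = true ↔ t ∈ Set.range c.action.enc) ∧
    (∀ t, code 1 t = true ↔ t ∈ Set.range c.observation.enc) ∧
    (∀ t, code 2 t = true ↔ t ∈ Set.range c.reward.enc) := by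
  obtain ⟨_, hA⟩ := c.action.decidable_range
  obtain ⟨_, hO⟩ := c.observation.decidable_range
  obtain ⟨_, hR⟩ := c.reward.decidable_range
  have hmod (r : ℕ) : Computable fun p : ℕ × List Bool => p.1 % 3 == r :=
    (Primrec.beq.comp (Primrec.nat_mod.comp Primrec.fst (Primrec.const 3))
      (Primrec.const r)).to_comp
  refine ⟨fun j t => bif j % 3 == 0 then decide (t ∈ Set.range c.action.enc)
    else bif j % 3 == 1 then decide (t ∈ Set.range c.observation.enc)
    else decide (t ∈ Set.range c.reward.enc), ?_, ?_, ?_, ?_, ?_⟩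
  · exact (Computable.cond (hmod 0) (hA.comp Computable.snd)
      (Computable.cond (hmod 1) (hO.comp Computable.snd) (hR.comp Computable.snd))).to₂
  · intro j; funext t; simp only [Nat.add_mod_right]
  all_goals intro t; simp

/-- A position of an output word in a history, possibly followed by an action. -/
theorem exists_of_words_eq {h : List (Step A O R)} {E V R' : List (List Bool)} {r : List Bool}
    (hE : E.length ≤ 1) (hV : c.words h ++ E = V ++ r :: R') (hj : V.length % 3 ≠ 0) :
    ∃ g, g <+: h ∧ inputPart 0 V = c.actions g ∧
      outputPart 0 (V ++ [r]) <+: c.percepts g := by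
  induction h generalizing V with
  | nil =>
    have := congrArg List.length hV
    simp [words] at this
    omega
  | cons e h ih =>
    rw [words_cons] at hV
    match V with
    | [] => simp at hj
    | [v₀] =>
      simp only [List.cons_append, List.nil_append, List.cons.injEq] at hV
      obtain ⟨rfl, rfl, -⟩ := hV
      exact ⟨[e], by simp, by simp [inputPart, actions], by simp [outputPart, percepts]⟩
    | [v₀, v₁] =>
      simp only [List.cons_append, List.nil_append, List.cons.injEq] at hV
      obtain ⟨rfl, rfl, rfl, -⟩ := hV
      exact ⟨[e], by simp, by simp [inputPart, actions], by simp [outputPart, percepts]⟩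
    | v₀ :: v₁ :: v₂ :: V =>
      simp only [List.cons_append, List.cons.injEq] at hV
      obtain ⟨rfl, rfl, rfl, hV⟩ := hV
      obtain ⟨g, hg, hi, ho⟩ := ih hV (by simpa [Nat.add_mod_right _ 3] using hj)
      refine ⟨e :: g, by simpa using hg, ?_, ?_⟩
      · simp [inputPart, inputPart_add_three 0, hi, actions]
      · simpa [outputPart, outputPart_add_three 0, percepts] using ho

end HistoryCode

section Prior

variable {A O R : Type*} {c : HistoryCode A O R} {U : MonotoneMachine}

/-- The possible extra word of `E` stands at an action position, so every output word belongs to a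
percept of `h`. -/
theorem ChronologicalOutputs.answersWords {w : ℕ → Bool} {h : List (Step A O R)}
    (hw : ChronologicalOutputs U c w h) {E : List (List Bool)} (hE : E.length ≤ 1) :
    AnswersWords U w (c.words h ++ E) := by
  intro V r R' hV hj
  obtain ⟨g, hg, hi, ho⟩ := c.exists_of_words_eq hE hV hj
  obtain ⟨s, x, p, hx, hp, hr⟩ := chronologicalOutputs_iff.1 hw g hg
  exact ⟨s, x, p, _, hi ▸ hx, hp, hr, ho⟩

/-- The percepts of `k` are all equal to `e`. -/
def ConstantPercepts (e : O × R) (k : List (Step A O R)) : Prop :=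
  ∀ s ∈ k, s.2 = e

theorem ConstantPercepts.of_prefix {e : O × R} {k l : List (Step A O R)}
    (hl : ConstantPercepts e l) (h : k <+: l) : ConstantPercepts e k :=
  fun s hs => hl s (h.subset hs)

theorem ConstantPercepts.percepts_eq {e : O × R} {k : List (Step A O R)}
    (hk : ConstantPercepts e k) : c.percepts k =
      (List.replicate k.length (c.observation.enc e.1 ++ c.reward.enc e.2)).flatten := by
  induction k with
  | nil => rfl
  | cons s k ih =>
    rw [List.length_cons, List.replicate_succ, List.flatten_cons,
      ← ih fun s hs => hk s (List.mem_cons_of_mem _ hs), ← hk s List.mem_cons_self]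
    rfl

/-- The words `E` that the stopping program reads after a history which is continued by `k`: either
none, or the first action of `k`. -/
def StopsAfter (c : HistoryCode A O R) (k : List (Step A O R)) (E : List (List Bool)) : Prop :=
  E = [] ∨ ∃ s l, k = s :: l ∧ E = [c.action.enc s.1]

/-- Initial parts of `h` are answered while the stopping program is being fed; longer ones are
answered by copies of the fixed percept after it has halted. If the stopping program also reads the
first action of `k`, the timing condition survives, because every longer initial part contains this
action. -/
theorem doom_chronologicalOutputs {code : ℕ → List Bool → Bool} {hcode : Computable₂ code}
    (hc : ∀ h, IsCoded code 0 (c.words h)) {e : O × R} {h k : List (Step A O R)}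
    (hk : ConstantPercepts e k) {E : List (List Bool)} (hE : StopsAfter c k E)
    {w₁ w₂ : ℕ → Bool} (h₁ : ChronologicalOutputs U c w₁ h) {p : List Bool} (hp : OnTape w₂ p)
    (h₂ : U.Halts (c.history h ++ E.flatten) p) :
    ChronologicalOutputs (doom U hcode (c.observation.enc e.1 ++ c.reward.enc e.2)) c
      (interleave (w₁, w₂)) (h ++ k) := by
  rw [chronologicalOutputs_iff]
  have hW : IsCoded code 0 (c.words h ++ E) := by
    rcases hE with rfl | ⟨s, l, rfl, rfl⟩
    · simpa using hc h
    · have := hc (h ++ [s])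
      rw [c.words_append, c.words_cons, ← List.singleton_append, ← List.append_assoc,
        isCoded_append] at this
      exact this.1
  have hElen : E.length ≤ 1 := by
    rcases hE with rfl | ⟨s, l, rfl, rfl⟩ <;> simp
  rw [← c.flatten_words, ← List.flatten_append] at h₂
  obtain ⟨hpre, hpost⟩ := doom_answers (hcode := hcode)
    (d₀ := c.observation.enc e.1 ++ c.reward.enc e.2) hW (h₁.answersWords hElen) hp h₂
  intro g hg
  have hsplit : g <+: h ∨ ∃ g', g = h ++ g' ∧ g' <+: k ∧ g' ≠ [] := by
    rcases List.prefix_or_prefix_of_prefix hg (List.prefix_append h k) with h' | h'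
    · exact Or.inl h'
    · obtain ⟨g', rfl⟩ := h'
      rw [List.prefix_append_right_inj] at hg
      by_cases hg' : g' = []
      · subst hg'; simp
      · exact Or.inr ⟨g', rfl, hg, hg'⟩
  rcases hsplit with hgh | ⟨g', rfl, hg', hne⟩
  · have : c.words g <+: c.words h ++ E := by
      obtain ⟨l, rfl⟩ := hgh
      rw [c.words_append, List.append_assoc]
      exact List.prefix_append _ _
    obtain ⟨s, x, P, hx, hP, hr⟩ := hpre _ this
    rw [c.inputPart_words] at hx
    rw [c.outputPart_words] at hr
    exact ⟨s, x, P, hx, hP, hr⟩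
  · obtain ⟨s, P, hP, hr⟩ := hpost g'.length
    refine ⟨s, inputPart 0 (c.words h ++ E), P, ?_, hP, ?_⟩
    rotate_left
    · rw [c.percepts_append, (hk.of_prefix hg').percepts_eq]
      convert hr using 2
      rcases hE with rfl | ⟨s, l, rfl, rfl⟩
      · rw [List.append_nil, c.outputPart_words]
      · rw [outputPart_concat, c.outputPart_words, c.length_words]; simp
    · rcases hE with rfl | ⟨s, l, rfl, rfl⟩
      · rw [List.append_nil, c.inputPart_words, c.actions_append]
        exact List.prefix_append _ _
      · rw [inputPart_concat, c.inputPart_words, c.length_words, c.actions_append,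
          List.prefix_append_right_inj]
        cases g' with
        | nil => exact absurd rfl hne
        | cons s' g' =>
          obtain ⟨rfl, -⟩ := List.cons_prefix_cons.1 hg'
          simp [HistoryCode.actions]

/-- After `h`, the percept `e` is issued forever with at least the stopping probability of `h` (or
of `h` and the next action), up to a constant factor. -/
theorem MonotoneMachine.IsUniversal.exists_mul_stopProb_le (hU : U.IsUniversal)
    (c : HistoryCode A O R) (e : O × R) : ∃ n : ℕ, ∀ h k : List (Step A O R),
      ConstantPercepts e k → ∀ E, StopsAfter c k E →
        2⁻¹ ^ n * U.stopProb (c.history h ++ E.flatten) *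
            randomTape {w | ChronologicalOutputs U c w h} ≤
          randomTape {w | ChronologicalOutputs U c w (h ++ k)} := by
  obtain ⟨code, hcode, hc, ha, ho, hr⟩ := c.exists_code
  obtain ⟨n, hn⟩ := hU.exists_mul_le c
    (doom U hcode (c.observation.enc e.1 ++ c.reward.enc e.2))
  refine ⟨n, fun h k hk E hE => le_trans ?_ (hn (h ++ k))⟩
  rw [mul_assoc, mul_comm (U.stopProb _), stopProb_eq]
  gcongr
  refine randomTape_mul_le fun w₁ h₁ w₂ h₂ => ?_
  obtain ⟨p, h₂, hp⟩ := h₂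
  exact doom_chronologicalOutputs (c.isCoded_words hc ha ho hr) hk hE h₁ hp h₂

theorem writer_chronologicalOutputs (w : ℕ → Bool) (h : List (Step A O R)) :
    ChronologicalOutputs (writer (c.percepts h)) c w h := by
  rintro g ⟨l, rfl⟩
  exact ⟨_, [], 0, List.nil_prefix, writer_reaches _ _ _ (c.percepts_append g l)⟩

/-- A machine that ignores its input and writes the percepts of `h` answers `h` on every tape.
Positivity makes the quotients defining `universalEnv` genuine conditional probabilities. -/
theorem MonotoneMachine.IsUniversal.universalPrior_pos (hU : U.IsUniversal)
    (c : HistoryCode A O R) (h : List (Step A O R)) : 0 < universalPrior U c h := by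
  obtain ⟨n, hn⟩ := hU.exists_mul_le c (writer (c.percepts h))
  refine ENNReal.toReal_pos (fun h₀ => ?_) (measure_ne_top _ _)
  have := hn h
  simp [h₀, writer_chronologicalOutputs] at this

theorem universalPrior_nonneg (U : MonotoneMachine) (c : HistoryCode A O R)
    (h : List (Step A O R)) : 0 ≤ universalPrior U c h := ENNReal.toReal_nonneg

theorem ofReal_universalPrior (U : MonotoneMachine) (c : HistoryCode A O R)
    (h : List (Step A O R)) :
    ENNReal.ofReal (universalPrior U c h) = randomTape {w | ChronologicalOutputs U c w h} :=
  ENNReal.ofReal_toReal (measure_ne_top _ _)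

theorem SelfDelimitingCode.countable {α : Type*} (d : SelfDelimitingCode α) : Countable α :=
  d.injective.countable

/-- Different percepts give disjoint events, all contained in the event for `h`. The mass that is
lost belongs to runs that issue no next percept. -/
theorem tsum_universalPrior_le (U : MonotoneMachine) (c : HistoryCode A O R)
    (h : List (Step A O R)) (a : A) :
    ∑' e : O × R, ENNReal.ofReal (universalPrior U c (h ++ [(a, e)])) ≤
      ENNReal.ofReal (universalPrior U c h) := by
  have := c.observation.countable
  have := c.reward.countable
  simp only [ofReal_universalPrior]
  rw [← measure_iUnion (f := fun e : O × R => {w | ChronologicalOutputs U c w (h ++ [(a, e)])})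
    _ fun e => measurableSet_chronologicalOutputs U c _]
  · refine measure_mono (Set.iUnion_subset fun e w hw => ?_)
    exact ChronologicalOutputs.of_prefix hw (List.prefix_append _ _)
  · exact fun e f hne => Set.disjoint_left.2 fun w he hf => hne (he.percept_unique hf)

end Prior

/-! ### Values -/

section Value

variable {A O R : Type*}

/-- The values of `ν` are nonnegative and add up to at most one. -/
structure IsSubprobability (ν : Environment A O R) : Prop where
  nonneg : ∀ h a e, 0 ≤ ν h a e
  tsum_le_one : ∀ h a, ∑' e, ENNReal.ofReal (ν h a e) ≤ 1

theorem isSubprobability_universalEnv (U : MonotoneMachine) (c : HistoryCode A O R) :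
    IsSubprobability (universalEnv U c) where
  nonneg h a e := div_nonneg (universalPrior_nonneg U c _) (universalPrior_nonneg U c _)
  tsum_le_one h a := by
    rcases (universalPrior_nonneg U c h).eq_or_lt with h₀ | h₀
    · simp [universalEnv, ← h₀]
    · simp only [universalEnv, ENNReal.ofReal_div_of_pos h₀]
      simp only [div_eq_mul_inv]
      rw [ENNReal.tsum_mul_right, ← div_eq_mul_inv]
      exact ENNReal.div_le_of_le_mul (by simpa using tsum_universalPrior_le U c h a)

variable {ν : Environment A O R} {π : Policy A O R} {h : List (Step A O R)}

theorem IsSubprobability.continuationProb_nonneg (hν : IsSubprobability ν) (π : Policy A O R)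
    (h k : List (Step A O R)) : 0 ≤ continuationProb π ν h k := by
  induction k generalizing h with
  | nil => exact zero_le_one
  | cons e k ih =>
    exact mul_nonneg (mul_nonneg ENNReal.toReal_nonneg (hν.nonneg _ _ _)) (ih _)

theorem tsum_ofFn_succ {α : Type*} (n : ℕ) (f : List α → ℝ≥0∞) :
    ∑' k : Fin (n + 1) → α, f (List.ofFn k) = ∑' (a : α) (k : Fin n → α), f (a :: List.ofFn k) := by
  rw [← (Fin.consEquiv fun _ : Fin (n + 1) => α).tsum_eq, ENNReal.tsum_prod']
  refine tsum_congr fun a => tsum_congr fun k => ?_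
  simp [Fin.consEquiv, List.ofFn_succ]

/-- Splitting off the first step leaves continuations of mass at most one, weighted by a law of the
action and a subprobability of percepts. -/
theorem IsSubprobability.tsum_continuationProb_le (hν : IsSubprobability ν) (π : Policy A O R)
    (h : List (Step A O R)) (n : ℕ) :
    ∑' k : Fin n → Step A O R, ENNReal.ofReal (continuationProb π ν h (List.ofFn k)) ≤ 1 := by
  induction n generalizing h with
  | zero => simp [continuationProb]
  | succ n ih =>
    rw [tsum_ofFn_succ n fun k => ENNReal.ofReal (continuationProb π ν h k)]
    calc ∑' (e : Step A O R) (k : Fin n → Step A O R),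
          ENNReal.ofReal (continuationProb π ν h (e :: List.ofFn k))
        ≤ ∑' e : Step A O R, π h e.1 * ENNReal.ofReal (ν h e.1 e.2) := by
          refine ENNReal.tsum_le_tsum fun e => ?_
          have : ∀ k : Fin n → Step A O R,
              ENNReal.ofReal (continuationProb π ν h (e :: List.ofFn k)) =
                π h e.1 * ENNReal.ofReal (ν h e.1 e.2) *
                  ENNReal.ofReal (continuationProb π ν (h ++ [e]) (List.ofFn k)) := by
            intro k
            rw [continuationProb, ENNReal.ofReal_mul
              (mul_nonneg ENNReal.toReal_nonneg (hν.nonneg _ _ _)),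
              ENNReal.ofReal_mul ENNReal.toReal_nonneg,
              ENNReal.ofReal_toReal ((π h).apply_ne_top _)]
          simp only [this]
          rw [ENNReal.tsum_mul_left]
          exact mul_le_of_le_one_right' (ih _)
      _ = ∑' a, π h a * ∑' e, ENNReal.ofReal (ν h a e) := by
          rw [ENNReal.tsum_prod']
          simp only [ENNReal.tsum_mul_left]
      _ ≤ ∑' a, π h a :=
          ENNReal.tsum_le_tsum fun a => mul_le_of_le_one_right' (hν.tsum_le_one h a)
      _ = 1 := (π h).tsum_coe

theorem IsSubprobability.summable_continuationProb (hν : IsSubprobability ν) (π : Policy A O R)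
    (h : List (Step A O R)) (n : ℕ) :
    Summable fun k : Fin n → Step A O R => continuationProb π ν h (List.ofFn k) := by
  have := ENNReal.summable_toReal
    ((hν.tsum_continuationProb_le π h n).trans_lt ENNReal.one_lt_top).ne
  simpa [ENNReal.toReal_ofReal, hν.continuationProb_nonneg] using this

theorem IsSubprobability.tsum_continuationProb_le_one (hν : IsSubprobability ν)
    (π : Policy A O R) (h : List (Step A O R)) (n : ℕ) :
    ∑' k : Fin n → Step A O R, continuationProb π ν h (List.ofFn k) ≤ 1 := by
  have := hν.tsum_continuationProb_le π h n
  rw [← ENNReal.ofReal_tsum_of_nonneg (fun k => hν.continuationProb_nonneg π h _)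
    (hν.summable_continuationProb π h n)] at this
  exact ENNReal.ofReal_le_one.1 this

/-- The expected reward of the step number `s` after `h`; it counts as `0` if it is not issued. -/
noncomputable def expectedReward (rew : R → ℝ) (π : Policy A O R) (ν : Environment A O R)
    (h : List (Step A O R)) (s : ℕ) : ℝ :=
  ∑' k : Fin (s + 1) → Step A O R,
    continuationProb π ν h (List.ofFn k) * rew (k (Fin.last s)).2.2

theorem value_eq (γ : ℝ) (rew : R → ℝ) (π : Policy A O R) (ν : Environment A O R)
    (h : List (Step A O R)) :
    value γ rew π ν h = (1 - γ) * ∑' s, γ ^ s * expectedReward rew π ν h s := rfl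

variable {rew : R → ℝ} {M : ℝ}

theorem IsSubprobability.summable_reward (hν : IsSubprobability ν) (hM : ∀ r, |rew r| ≤ M)
    (π : Policy A O R) (h : List (Step A O R)) (s : ℕ) :
    Summable fun k : Fin (s + 1) → Step A O R =>
      continuationProb π ν h (List.ofFn k) * rew (k (Fin.last s)).2.2 := by
  refine Summable.of_norm_bounded ((hν.summable_continuationProb π h (s + 1)).mul_right M)
    fun k => ?_
  rw [norm_mul, Real.norm_of_nonneg (hν.continuationProb_nonneg π h _), Real.norm_eq_abs]
  exact mul_le_mul_of_nonneg_left (hM _) (hν.continuationProb_nonneg π h _)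

theorem IsSubprobability.abs_expectedReward_le (hν : IsSubprobability ν) (hM : ∀ r, |rew r| ≤ M)
    (hM₀ : 0 ≤ M) (π : Policy A O R) (h : List (Step A O R)) (s : ℕ) :
    |expectedReward rew π ν h s| ≤ M := by
  have hs := hν.summable_continuationProb π h (s + 1)
  calc |expectedReward rew π ν h s|
      ≤ ∑' k : Fin (s + 1) → Step A O R, continuationProb π ν h (List.ofFn k) * M := by
        rw [← Real.norm_eq_abs]
        refine tsum_of_norm_bounded (hs.mul_right M).hasSum fun k => ?_
        rw [norm_mul, Real.norm_of_nonneg (hν.continuationProb_nonneg π h _), Real.norm_eq_abs]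
        exact mul_le_mul_of_nonneg_left (hM _) (hν.continuationProb_nonneg π h _)
    _ ≤ 1 * M := by
        rw [tsum_mul_right]
        exact mul_le_mul_of_nonneg_right (hν.tsum_continuationProb_le_one π h _) hM₀
    _ = M := one_mul M

theorem IsSubprobability.summable_discounted (hν : IsSubprobability ν) (hM : ∀ r, |rew r| ≤ M)
    (hM₀ : 0 ≤ M) {γ : ℝ} (hγ : γ ∈ Set.Ioo (0 : ℝ) 1) (π : Policy A O R)
    (h : List (Step A O R)) : Summable fun s => γ ^ s * expectedReward rew π ν h s := by
  refine Summable.of_norm_bounded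
    ((summable_geometric_of_lt_one hγ.1.le hγ.2).mul_right M) fun s => ?_
  rw [norm_mul, Real.norm_of_nonneg (pow_nonneg hγ.1.le s), Real.norm_eq_abs]
  exact mul_le_mul_of_nonneg_left (hν.abs_expectedReward_le hM hM₀ π h s) (pow_nonneg hγ.1.le s)

/-- A bound of the expected rewards at all times is a bound of the value. -/
theorem IsSubprobability.value_le (hν : IsSubprobability ν) (hM : ∀ r, |rew r| ≤ M)
    (hM₀ : 0 ≤ M) {γ : ℝ} (hγ : γ ∈ Set.Ioo (0 : ℝ) 1) {B : ℝ}
    (hB : ∀ s, expectedReward rew π ν h s ≤ B) : value γ rew π ν h ≤ B := by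
  have hγ' : 0 < 1 - γ := sub_pos.2 hγ.2
  rw [value_eq]
  calc (1 - γ) * ∑' s, γ ^ s * expectedReward rew π ν h s
      ≤ (1 - γ) * ∑' s, γ ^ s * B := by
        refine mul_le_mul_of_nonneg_left ?_ hγ'.le
        exact Summable.tsum_le_tsum
          (fun s => mul_le_mul_of_nonneg_left (hB s) (pow_nonneg hγ.1.le s))
          (hν.summable_discounted hM hM₀ hγ π h)
          ((summable_geometric_of_lt_one hγ.1.le hγ.2).mul_right B)
    _ = B := by
        rw [tsum_mul_right, tsum_geometric_of_lt_one hγ.1.le hγ.2, ← mul_assoc,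
          mul_inv_cancel₀ hγ'.ne', one_mul]

/-! ### Values when one percept is repeated forever -/

/-- The probability that `π` takes the actions `l` after `h` if all percepts are `e`. -/
noncomputable def actionProb (π : Policy A O R) (e : O × R) :
    List (Step A O R) → List A → ℝ≥0∞
  | _, [] => 1
  | h, a :: l => π h a * actionProb π e (h ++ [(a, e)]) l

theorem actionProb_ne_top (π : Policy A O R) (e : O × R) (h : List (Step A O R)) (l : List A) :
    actionProb π e h l ≠ ⊤ := by
  induction l generalizing h with
  | nil => exact ENNReal.one_ne_top
  | cons a l ih => exact ENNReal.mul_ne_top ((π h).apply_ne_top a) (ih _)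

theorem tsum_actionProb (π : Policy A O R) (e : O × R) (h : List (Step A O R)) (n : ℕ) :
    ∑' l : Fin n → A, actionProb π e h (List.ofFn l) = 1 := by
  induction n generalizing h with
  | zero => simp [actionProb]
  | succ n ih =>
    rw [tsum_ofFn_succ n fun l => actionProb π e h l]
    simp only [actionProb, ENNReal.tsum_mul_left, ih, mul_one]
    exact (π h).tsum_coe

/-- The conditional probabilities telescope. -/
theorem continuationProb_universalEnv {U : MonotoneMachine} {c : HistoryCode A O R}
    (hpos : ∀ h, 0 < universalPrior U c h) (π : Policy A O R) (e : O × R)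
    (h : List (Step A O R)) (l : List A) :
    continuationProb π (universalEnv U c) h (l.map fun a => (a, e)) =
      (actionProb π e h l).toReal *
        (universalPrior U c (h ++ l.map fun a => (a, e)) / universalPrior U c h) := by
  induction l generalizing h with
  | nil => simp [continuationProb, actionProb, (hpos h).ne']
  | cons a l ih =>
    rw [List.map_cons, continuationProb, ih, actionProb, ENNReal.toReal_mul]
    have h₁ := (hpos h).ne'
    have h₂ := (hpos (h ++ [(a, e)])).ne'
    simp only [universalEnv, List.append_assoc, List.singleton_append] at *
    field_simp

theorem abs_le_max_of_mem_Icc {x L : ℝ} (hx : x ∈ Set.Icc (-L) 1) : |x| ≤ max |L| 1 := by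
  refine abs_le.2 ⟨?_, hx.2.trans (le_max_right _ _)⟩
  have := (le_abs_self L).trans (le_max_left _ 1)
  linarith [hx.1]

/-- If, after `h` and an action of `π`, the percept `e` with the reward `-L` is issued forever with
probability at least `q`, then the value of `π` is at most `1 - (1 + L) * q`. -/
theorem value_le_of_constant_percepts {U : MonotoneMachine} {c : HistoryCode A O R}
    (hpos : ∀ h, 0 < universalPrior U c h) {L : ℝ}
    (hrew : ∀ r, rew r ∈ Set.Icc (-L) 1) {e : O × R} (he : rew e.2 = -L) {γ : ℝ}
    (hγ : γ ∈ Set.Ioo (0 : ℝ) 1) {q : ℝ} (hq : 0 ≤ q)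
    (hdoom : ∀ a ∈ (π h).support, ∀ l : List A, q * universalPrior U c h ≤
      universalPrior U c (h ++ (a :: l).map fun a => (a, e))) :
    value γ rew π (universalEnv U c) h ≤ 1 - (1 + L) * q := by
  have hν := isSubprobability_universalEnv U c
  have hM : ∀ r, |rew r| ≤ max |L| 1 := fun r => abs_le_max_of_mem_Icc (hrew r)
  refine hν.value_le hM (zero_le_one.trans (le_max_right _ _)) hγ fun s => ?_
  have hcp := hν.summable_continuationProb π h (s + 1)
  have hre := hν.summable_reward hM π h s
  have hnn := hν.continuationProb_nonneg π h
  set cp := continuationProb π (universalEnv U c) h with hcpdef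
  let i : (Fin (s + 1) → A) → (Fin (s + 1) → Step A O R) := fun l j => (l j, e)
  have hi : Function.Injective i := fun l l' hl => funext fun j =>
    congrArg Prod.fst (congrFun hl j)
  have hofFn : ∀ l, List.ofFn (i l) = (List.ofFn l).map fun a => (a, e) := fun l => by
    rw [List.map_ofFn]; rfl
  have hterm : ∀ l : Fin (s + 1) → A,
      actionProb π e h (List.ofFn l) * ENNReal.ofReal q ≤
        ENNReal.ofReal (cp (List.ofFn (i l))) := by
    intro l
    rw [hofFn, hcpdef, continuationProb_universalEnv hpos,
      ENNReal.ofReal_mul ENNReal.toReal_nonneg, ENNReal.ofReal_toReal (actionProb_ne_top _ _ _ _)]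
    -- `hdoom` speaks only of first actions that `π` takes with positive probability.
    by_cases h₀ : actionProb π e h (List.ofFn l) = 0
    · rw [h₀, zero_mul, zero_mul]
    gcongr
    rw [le_div_iff₀ (hpos h), List.ofFn_succ]
    refine hdoom _ ?_ _
    rw [List.ofFn_succ, actionProb] at h₀
    exact (PMF.mem_support_iff _ _).2 (left_ne_zero_of_mul h₀)
  -- The deficit `1 - rew` is nonnegative and equals `1 + L` on the percept `e`. Restricting its sum
  -- to continuations with constant percept `e` gives a lower bound; as the total mass is at most
  -- one, the expected reward is at most one minus this deficit.
  have hmass : ENNReal.ofReal ((1 + L) * q) ≤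
      ENNReal.ofReal (∑' k : Fin (s + 1) → Step A O R,
        cp (List.ofFn k) * (1 - rew (k (Fin.last s)).2.2)) := by
    have hsum : Summable fun k : Fin (s + 1) → Step A O R =>
        cp (List.ofFn k) * (1 - rew (k (Fin.last s)).2.2) := by
      simpa only [mul_sub, mul_one] using hcp.sub hre
    rw [ENNReal.ofReal_tsum_of_nonneg (fun k => mul_nonneg (hnn _) (sub_nonneg.2 (hrew _).2)) hsum]
    calc ENNReal.ofReal ((1 + L) * q)
        = ∑' l : Fin (s + 1) → A, actionProb π e h (List.ofFn l) * ENNReal.ofReal q *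
            ENNReal.ofReal (1 + L) := by
          rw [ENNReal.tsum_mul_right, ENNReal.tsum_mul_right, tsum_actionProb, one_mul, mul_comm,
            ENNReal.ofReal_mul hq]
      _ ≤ ∑' l, ENNReal.ofReal (cp (List.ofFn (i l)) * (1 - rew ((i l) (Fin.last s)).2.2)) := by
          refine ENNReal.tsum_le_tsum fun l => ?_
          rw [ENNReal.ofReal_mul (hnn _)]
          refine mul_le_mul' (hterm l) (ENNReal.ofReal_le_ofReal ?_)
          change 1 + L ≤ 1 - rew e.2
          rw [he]; linarith
      _ ≤ _ := ENNReal.tsum_comp_le_tsum_of_injective hi fun k =>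
          ENNReal.ofReal (cp (List.ofFn k) * (1 - rew (k (Fin.last s)).2.2))
  have hmass' := (ENNReal.ofReal_le_ofReal_iff (tsum_nonneg fun k =>
    mul_nonneg (hnn _) (sub_nonneg.2 (hrew _).2))).1 hmass
  simp only [mul_sub, mul_one] at hmass'
  rw [hcp.tsum_sub hre] at hmass'
  have := hν.tsum_continuationProb_le_one π h (s + 1)
  change ∑' k : Fin (s + 1) → Step A O R, cp (List.ofFn k) * rew (k (Fin.last s)).2.2 ≤ _
  linarith

/-! ### Changing the law of the next action -/

open Classical in
/-- The policy that acts like `π`, except that it samples its action from `p` at `h`. -/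
noncomputable def Policy.updateAt (π : Policy A O R) (h : List (Step A O R)) (p : PMF A) :
    Policy A O R :=
  Function.update π h p

theorem Policy.updateAt_self (π : Policy A O R) (h : List (Step A O R)) (p : PMF A) :
    π.updateAt h p h = p := by
  simp [updateAt]

theorem Policy.updateAt_of_ne (π : Policy A O R) {h g : List (Step A O R)} (p : PMF A)
    (hg : g ≠ h) : π.updateAt h p g = π g := by
  classical
  unfold Policy.updateAt
  convert Function.update_of_ne hg p π

/-- Histories only get longer, so a change at `h` is never met again. -/
theorem continuationProb_updateAt_of_lt (π : Policy A O R) (ν : Environment A O R) {p : PMF A}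
    {g : List (Step A O R)} (hg : h.length < g.length) (k : List (Step A O R)) :
    continuationProb (π.updateAt h p) ν g k = continuationProb π ν g k := by
  induction k generalizing g with
  | nil => rfl
  | cons e k ih =>
    have hne : g ≠ h := fun hgh => hg.ne (congrArg List.length hgh).symm
    rw [continuationProb, continuationProb, ih (by simp; omega)]
    rw [Policy.updateAt_of_ne π p hne]

/-- The value depends on the law of the next action in an affine way. -/
theorem IsSubprobability.value_eq_add (hν : IsSubprobability ν) (hM : ∀ r, |rew r| ≤ M)
    (hM₀ : 0 ≤ M) {γ : ℝ} (hγ : γ ∈ Set.Ioo (0 : ℝ) 1) {p₁ p₂ : PMF A} {t₁ t₂ : ℝ}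
    (hp : ∀ x, (π h x).toReal = t₁ * (p₁ x).toReal + t₂ * (p₂ x).toReal) :
    value γ rew π ν h =
      t₁ * value γ rew (π.updateAt h p₁) ν h + t₂ * value γ rew (π.updateAt h p₂) ν h := by
  have hE : ∀ s, expectedReward rew π ν h s =
      t₁ * expectedReward rew (π.updateAt h p₁) ν h s +
        t₂ * expectedReward rew (π.updateAt h p₂) ν h s := by
    intro s
    unfold expectedReward
    rw [← tsum_mul_left, ← tsum_mul_left, ← Summable.tsum_add
      ((hν.summable_reward hM _ h s).mul_left t₁) ((hν.summable_reward hM _ h s).mul_left t₂)]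
    refine tsum_congr fun k => ?_
    rw [List.ofFn_succ]
    simp only [continuationProb, Policy.updateAt_self,
      continuationProb_updateAt_of_lt π ν (h := h) (g := h ++ [k 0]) (by simp), hp]
    ring
  simp only [value_eq, hE, mul_add]
  rw [Summable.tsum_add]
  · simp only [mul_left_comm _ t₁, mul_left_comm _ t₂, tsum_mul_left]
    ring
  · simpa only [mul_left_comm _ t₁] using (hν.summable_discounted hM hM₀ hγ _ h).mul_left t₁
  · simpa only [mul_left_comm _ t₂] using (hν.summable_discounted hM hM₀ hγ _ h).mul_left t₂

/-- Here `p'` is `p` conditioned on not choosing `a`. -/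
theorem PMF.exists_eq_add_pure (p : PMF A) (a : A) : ∃ p' : PMF A, ∀ x,
    (p x).toReal = (p a).toReal * (PMF.pure a x).toReal + (1 - (p a).toReal) * (p' x).toReal := by
  classical
  set f : A → ℝ≥0∞ := fun x => if x = a then 0 else p x with hf
  have hsum : p a + ∑' x, f x = 1 := by
    rw [← p.tsum_coe]
    exact (ENNReal.tsum_eq_add_tsum_ite (f := fun x => p x) a).symm
  have hf' : ∑' x, f x = 1 - p a := by
    rw [← hsum, ENNReal.add_sub_cancel_left (p.apply_ne_top a)]
  have hle : p a ≤ 1 := p.coe_le_one a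
  by_cases h₀ : ∑' x, f x = 0
  · refine ⟨p, fun x => ?_⟩
    rw [h₀, add_zero] at hsum
    rw [ENNReal.tsum_eq_zero] at h₀
    have := h₀ x
    by_cases hx : x = a
    · subst hx; simp [hsum]
    · simp only [hf, hx, if_false] at this
      simp [this, hx]
  · have htop : ∑' x, f x ≠ ⊤ := by rw [hf']; exact ENNReal.sub_ne_top ENNReal.one_ne_top
    refine ⟨PMF.normalize f h₀ htop, fun x => ?_⟩
    have hreal : 1 - (p a).toReal = (∑' x, f x).toReal := by
      rw [hf', ENNReal.toReal_sub_of_le hle ENNReal.one_ne_top, ENNReal.toReal_one]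
    rw [hreal, PMF.normalize_apply, ENNReal.toReal_mul, ENNReal.toReal_inv]
    have hne : (∑' x, f x).toReal ≠ 0 := ENNReal.toReal_ne_zero.2 ⟨h₀, htop⟩
    rw [mul_comm (f x).toReal, mul_inv_cancel_left₀ hne]
    by_cases hx : x = a
    · subst hx; simp [hf]
    · simp [hf, hx]

end Value

/-! ### Safety -/

/-- A fired safety trigger leaves the counter positive: it is `1`, or the `H > 0` of a random
trigger that overrides it, or the nonzero value of a rollout in progress. -/
theorem AgentState.OptimizerActs.not_safety {ι : Type*} {σ : AgentState ι} {safety : Prop} {m : ι}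
    {H : ℕ} {coin : Option ι} (h : σ.OptimizerActs safety m H coin) (hH : 0 < H) : ¬ safety := by
  intro hs
  apply h
  unfold AgentState.update
  split_ifs with h₀
  · cases coin <;> simp [hH]
  · exact Nat.pos_of_ne_zero h₀

section Safety

variable {A O R : Type*} {U : MonotoneMachine} {c : HistoryCode A O R}

theorem universalPrior_le_of_stopProb {e : O × R} {n : ℕ}
    (hn : ∀ h k : List (Step A O R), ConstantPercepts e k → ∀ E, StopsAfter c k E →
      2⁻¹ ^ n * U.stopProb (c.history h ++ E.flatten) *
          randomTape {w | ChronologicalOutputs U c w h} ≤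
        randomTape {w | ChronologicalOutputs U c w (h ++ k)})
    {L : ℝ} (hL : -1 < L) {h k : List (Step A O R)} (hk : ConstantPercepts e k)
    {E : List (List Bool)} (hE : StopsAfter c k E)
    (hlarge : ENNReal.ofReal (2 ^ (n + 1) / (L + 1)) ≤ U.stopProb (c.history h ++ E.flatten)) :
    2 / (L + 1) * universalPrior U c h ≤ universalPrior U c (h ++ k) := by
  have hL' : 0 < L + 1 := by linarith
  have hq : ENNReal.ofReal (2 / (L + 1)) ≤
      2⁻¹ ^ n * U.stopProb (c.history h ++ E.flatten) := by
    refine le_trans (le_of_eq ?_) (mul_le_mul_right hlarge _)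
    have : (2⁻¹ : ℝ≥0∞) ^ n = ENNReal.ofReal (2⁻¹ ^ n) := by
      rw [ENNReal.ofReal_pow (by norm_num), ENNReal.ofReal_inv_of_pos two_pos,
        ENNReal.ofReal_ofNat]
    rw [this, ← ENNReal.ofReal_mul (by positivity)]
    congr 1
    rw [inv_pow]
    field_simp
    ring
  have := (mul_le_mul_left hq _).trans (hn h k hk E hE)
  rw [← ofReal_universalPrior, ← ofReal_universalPrior, ← ENNReal.ofReal_mul (by positivity)]
    at this
  exact (ENNReal.ofReal_le_ofReal_iff (universalPrior_nonneg U c _)).1 this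

theorem constantPercepts_map (e : O × R) (l : List A) :
    ConstantPercepts e (l.map fun a => (a, e) : List (Step A O R)) := by
  intro s hs
  obtain ⟨a, -, rfl⟩ := List.mem_map.1 hs
  rfl

end Safety

theorem theorem3 {A O R : Type*} [Nonempty A] [Nonempty O]
    (U : MonotoneMachine) (hU : U.IsUniversal) (c : HistoryCode A O R) (rmin : R) :
    ∃ C : ℝ, 0 < C ∧
      ∀ (L : ℝ), -1 < L →
      ∀ (rew : R → ℝ), (∀ r : R, rew r ∈ Set.Icc (-L) 1) → rew rmin = -L →
      ∀ (γ : ℝ), γ ∈ Set.Ioo (0 : ℝ) 1 →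
      ∀ (h : List (Step A O R)),
        (ENNReal.ofReal (C / (L + 1)) ≤ U.stopProb (c.history h) →
          optimalValue γ rew (universalEnv U c) h ≤ -1 ∧
          ∀ (ι : Type*) (σ : AgentState ι) (m : ι) (H : ℕ → ℕ) (coin : Option ι),
            (∀ t : ℕ, 0 < H t) →
            ¬ σ.OptimizerActs (optimalValue γ rew (universalEnv U c) h ≤ -1) m
                (H (h.length + 1)) coin) ∧
        (∀ (ι : Type*) (σ : AgentState ι) (m : ι) (H : ℕ → ℕ) (coin : Option ι),
            (∀ t : ℕ, 0 < H t) →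
            σ.OptimizerActs (optimalValue γ rew (universalEnv U c) h ≤ -1) m
                (H (h.length + 1)) coin →
            ∀ (πopt : Policy A O R), IsOptimalAt γ rew (universalEnv U c) πopt h →
            ∀ a ∈ (πopt h).support,
              U.stopProb (c.history h ++ c.action.enc a) < ENNReal.ofReal (C / (L + 1))) := by
  obtain ⟨o⟩ := ‹Nonempty O›
  -- The observation in the repeated percept is arbitrary. The exponent `n` is fixed before `L`, the
  -- reward values, `γ` and the history are introduced.
  obtain ⟨n, hn⟩ := hU.exists_mul_stopProb_le c (o, rmin)
  refine ⟨2 ^ (n + 1), by positivity, fun L hL rew hrew hmin γ hγ h => ?_⟩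
  have hL' : 0 < L + 1 := by linarith
  have hq : (0 : ℝ) ≤ 2 / (L + 1) := by positivity
  have hB : 1 - (1 + L) * (2 / (L + 1)) = -1 := by
    field_simp
    ring
  have hpos := hU.universalPrior_pos c
  have hν := isSubprobability_universalEnv U c
  have : Nonempty (Policy A O R) := ⟨fun _ => PMF.pure (Classical.arbitrary A)⟩
  refine ⟨fun hlarge => ?_, ?_⟩
  · have hV : optimalValue γ rew (universalEnv U c) h ≤ -1 := by
      refine ciSup_le fun π => ?_
      rw [← hB]
      refine value_le_of_constant_percepts hpos hrew (e := (o, rmin)) hmin hγ hq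
        fun a _ l => ?_
      exact universalPrior_le_of_stopProb hn hL (constantPercepts_map _ _) (E := []) (Or.inl rfl)
        (by simpa using hlarge)
    exact ⟨hV, fun ι σ m H coin hH hact => hact.not_safety (hH _) hV⟩
  · intro ι σ m H coin hH hact π hπ a ha
    by_contra! hlarge
    refine hact.not_safety (hH _) (ciSup_le fun π' => (hπ π').trans ?_)
    -- Playing `a` surely at `h` makes the stopping probability of `h` followed by `a` available to
    -- the bound.
    have hbad : value γ rew (π.updateAt h (PMF.pure a)) (universalEnv U c) h ≤ -1 := by
      rw [← hB]
      refine value_le_of_constant_percepts hpos hrew (e := (o, rmin)) hmin hγ hq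
        fun b hb l => ?_
      rw [Policy.updateAt_self, PMF.support_pure, Set.mem_singleton_iff] at hb
      subst hb
      exact universalPrior_le_of_stopProb hn hL (constantPercepts_map _ _)
        (E := [c.action.enc b]) (Or.inr ⟨_, _, rfl, rfl⟩) (by simpa using hlarge)
    obtain ⟨p', hp'⟩ := (π h).exists_eq_add_pure a
    have hM : ∀ r, |rew r| ≤ max |L| 1 := fun r => abs_le_max_of_mem_Icc (hrew r)
    have hsplit := hν.value_eq_add hM (zero_le_one.trans (le_max_right _ _)) hγ hp'
    have hle := hπ (π.updateAt h p')
    have hpa : 0 < (π h a).toReal :=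
      ENNReal.toReal_pos ((PMF.mem_support_iff _ _).1 ha) ((π h).apply_ne_top a)
    have hpa' : 0 ≤ 1 - (π h a).toReal :=
      sub_nonneg.2 (ENNReal.toReal_le_of_le_ofReal zero_le_one
        (by simpa using (π h).coe_le_one a))
    have h₁ := mul_le_mul_of_nonneg_left hbad hpa.le
    have h₂ := mul_le_mul_of_nonneg_left hle hpa'
    -- With `p = π(a | h)`, the value is a mixture: `V = p * V_a + (1 - p) * V'`, where `V_a ≤ -1`
    -- and `V' ≤ V` by optimality. Hence `p * V ≤ -p`, and `p > 0` can be cancelled.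
    have h₃ : (π h a).toReal * value γ rew π (universalEnv U c) h ≤ (π h a).toReal * -1 := by
      linarith
    exact le_of_mul_le_mul_left h₃ hpa
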